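/- Let $\mathcal A$ be a complete and cocomplete abelian category with a closed symmetric monoidal structure $(\otimes, k, [-,-])$, and let $Ch(\mathcal A)$ be the category of $\mathbb Z$-graded chain complexes in $\mathcal A$ (differentials of degree $-1$), with the symmetric monoidal structure $(X\otimes Y)_n=\bigoplus_{p+q=n}X_p\otimes Y_q$, $d(x\otimes y)=dx\otimes y+(-1)^{|x|}x\otimes dy$, with unit $k$ in degree $0$ and with symmetry $x\otimes y\mapsto(-1)^{|x||y|}y\otimes x$. For chain complexes $X,Y$ let $$\underline{Hom}^{\mathcal A}(X,Y)=\ker\Big(\prod_n[X_n,Y_n]\longrightarrow\prod_n[X_n,Y_{n-1}],\ f\mapsto d_Yf-fd_X\Big)\in\mathcal A$$ be the object of chain maps (the $0$-cycles of the internal Hom complex), with evaluations $ev_n:\underline{Hom}^{\mathcal A}(X,Y)\to[X_n,Y_n]$. This makes $Ch(\mathcal A)$ a symmetric monoidal $\mathcal A$-category. For a chain complex $V$ and an object $W$ of $\mathcal A$, let $End^{\mathcal A}(V)$ and $End(W)$ be the endomorphism operads in $\mathcal A$, with $End^{\mathcal A}(V)_n=\underline{Hom}^{\mathcal A}(V^{\otimes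 n},V)$ and $End(W)_n=[W^{\otimes n},W]$ for $n\ge 0$: the symmetric group $\Sigma_n$ acts on the right by precomposition with the permutations of the tensor factors, the unit is the identity, and the composition $\gamma(f;f_1,\dots,f_l)=f\circ(f_1\otimes\cdots\otimes f_l)$ is given by the tensor product of maps followed by composition. Let $V=(\cdots\to0\to V_1\xrightarrow{d}V_0\to0\to\cdots)$ be a chain complex in $\mathcal A$ concentrated in degrees $0$ and $1$. For $n\ge0$, the object $(V_1\oplus V_0)^{\otimes n}$ is the direct sum of all words $V_{\epsilon_1}\otimes\cdots\otimes V_{\epsilon_n}$ with $\epsilon_i\in\{0,1\}$. Let $$\partial:(V_1\oplus V_0)^{\otimes n}\longrightarrow(V^{\otimes n})_1\oplus(V^{\otimes n})_0$$ be the following map. On the word $V_0^{\otimes n}$ it is the identity onto the summand $V_0^{\otimes n}=(V^{\otimes n})_0$. On a word containing at least one copy of $V_1$, it applies $d$ to every copy of $V_1$ except the leftmost one, and the identity to the leftmost copy of $V_1$ and to all copies of $V_0$; it thus maps this word to the summand of $(V^{\otimes n})_1$ given by the word whose only copy of $V_1$ is at the place of that leftmost one. Let $\rtimes_n:End^{\mathcal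 A}(V)_n\to End(V_1\oplus V_0)_n$ be the composite $$\underline{Hom}^{\mathcal A}(V^{\otimes n},V)\xrightarrow{(ev_1,ev_0)}[(V^{\otimes n})_1,V_1]\oplus[(V^{\otimes n})_0,V_0]\xrightarrow{\ diag\ }[(V^{\otimes n})_1\oplus(V^{\otimes n})_0,V_1\oplus V_0]\xrightarrow{\ \partial^*\ }[(V_1\oplus V_0)^{\otimes n},V_1\oplus V_0],$$ where $diag$ is $(g,h)\mapsto g\oplus h$ and $\partial^*$ is the precomposition with $\partial$; that is, $\rtimes_n(f)=(f_1\oplus f_0)\circ\partial$. Then $\rtimes=(\rtimes_n)_{n\ge0}:End^{\mathcal A}(V)\to End(V_1\oplus V_0)$ is a morphism of symmetric operads in $\mathcal A$: it is compatible with the actions of the symmetric groups $\Sigma_n$ for all $n\ge0$, with the units, and with all operadic compositions $\gamma$. -/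

import Mathlib

open CategoryTheory Category Limits MonoidalCategory
universe v u
set_option linter.unusedSectionVars false

noncomputable section

/-! ### The symmetric monoidal category of chain complexes -/

/-- The usual signs for the tensor product of `ℤ`-graded chain complexes. -/
instance : (ComplexShape.down ℤ).TensorSigns where
  ε' := MonoidHom.mk' Int.negOnePow Int.negOnePow_add
  rel_add p q r (hpq : q + 1 = p) := show q + r + 1 = p + r by omega
  add_rel p q r (hpq : q + 1 = p) := show r + q + 1 = r + p by omega
  ε'_succ := by
    rintro _ q rfl
    exact (by rw [Int.negOnePow_succ, neg_neg] : Int.negOnePow q = - Int.negOnePow (q+1))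

variable (A : Type u) [Category.{v} A] [Abelian A] [MonoidalCategory A] [SymmetricCategory A]
  [MonoidalClosed A]

/-- In a closed symmetric monoidal abelian category, the tensor product is biadditive. -/
instance monoidalPreadditive_of_closed : MonoidalPreadditive A := by
  have h (F : A ⥤ A) [F.IsLeftAdjoint] : F.Additive := by
    have : PreservesColimitsOfSize.{0, 0} F :=
      (Adjunction.ofIsLeftAdjoint F).leftAdjoint_preservesColimits
    have := preservesBinaryBiproducts_of_preservesBinaryCoproducts F
    exact Functor.additive_of_preservesBinaryBiproducts F
  have h1 (X : A) : (tensorLeft X).Additive := h _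
  have h2 (X : A) : (tensorRight X).Additive := h _
  exact
  { whiskerLeft_zero := fun {X Y Z} => (tensorLeft X).map_zero Y Z
    zero_whiskerRight := fun {X Y Z} => (tensorRight X).map_zero Y Z
    whiskerLeft_add := fun {X Y Z} f g => (tensorLeft X).map_add
    add_whiskerRight := fun {X Y Z} f g => (tensorRight X).map_add }

variable [HasLimits A] [HasColimits A]

instance (X : A) : PreservesColimitsOfSize.{0,0} ((curriedTensor A).obj X) :=
  (ihom.adjunction X).leftAdjoint_preservesColimits
instance (X : A) : PreservesColimitsOfSize.{0,0} ((curriedTensor A).flip.obj X) :=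
  (Adjunction.ofIsLeftAdjoint (tensorRight X)).leftAdjoint_preservesColimits


instance gradedHasTensor (X₁ X₂ : GradedObject ℤ A) : GradedObject.HasTensor X₁ X₂ := inferInstance
instance gradedGood₁₂ (X₁ X₂ X₃ : GradedObject ℤ A) :
    GradedObject.HasGoodTensor₁₂Tensor X₁ X₂ X₃ := inferInstance
instance gradedGood₂₃ (X₁ X₂ X₃ : GradedObject ℤ A) :
    GradedObject.HasGoodTensorTensor₂₃ X₁ X₂ X₃ := inferInstance
instance graded₄ (X₁ X₂ X₃ X₄ : GradedObject ℤ A) :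
    GradedObject.HasTensor₄ObjExt X₁ X₂ X₃ X₄ := inferInstance

variable {A}
namespace KoszulBraiding
open GradedObject GradedObject.Monoidal

lemma units_smul_comp' {X Y Z : A} (r : ℤˣ) (f : X ⟶ Y) (g : Y ⟶ Z) : (r • f) ≫ g = r • (f ≫ g) := by
  obtain rfl | rfl := Int.units_eq_one_or r <;> simp [Units.smul_def]

lemma comp_units_smul' {X Y Z : A} (r : ℤˣ) (f : X ⟶ Y) (g : Y ⟶ Z) : f ≫ (r • g) = r • (f ≫ g) := by
  obtain rfl | rfl := Int.units_eq_one_or r <;> simp [Units.smul_def]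

lemma whiskerLeft_units_smul (X : A) {Y Z : A} (r : ℤˣ) (f : Y ⟶ Z) : X ◁ (r • f) = r • (X ◁ f) := by
  obtain rfl | rfl := Int.units_eq_one_or r
  · simp
  · simpa [Units.smul_def] using (tensorLeft X).map_neg (f := f)
lemma units_smul_whiskerRight (X : A) {Y Z : A} (r : ℤˣ) (f : Y ⟶ Z) : (r • f) ▷ X = r • (f ▷ X) := by
  obtain rfl | rfl := Int.units_eq_one_or r
  · simp
  · rw [Units.smul_def, Units.smul_def]; simp only [Units.val_neg, Units.val_one, neg_smul, one_smul]
    exact (tensorRight X).map_neg (f := f)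

/-- The braiding of graded objects, with the Koszul sign: `x ⊗ y ↦ (-1) ^ (i * j) • y ⊗ x` for `x` of
degree `i` and `y` of degree `j`. -/
def braidHom (X Y : GradedObject ℤ A) : GradedObject.Monoidal.tensorObj X Y ⟶ GradedObject.Monoidal.tensorObj Y X :=
  fun k => tensorObjDesc (fun i j hij => (i * j).negOnePow • ((β_ (X i) (Y j)).hom ≫
    ιTensorObj Y X j i k ((add_comm j i).trans hij)))

lemma ι_braidHom (X Y : GradedObject ℤ A) (i j k : ℤ) (h : i + j = k) :
    ιTensorObj X Y i j k h ≫ braidHom X Y k = (i * j).negOnePow • ((β_ (X i) (Y j)).hom ≫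
    ιTensorObj Y X j i k ((add_comm j i).trans h)) :=
  ι_tensorObjDesc _ _ _ _

lemma koszul_symm (X Y : GradedObject ℤ A) : braidHom X Y ≫ braidHom Y X = 𝟙 _ := by
  ext k i j h
  change ιTensorObj X Y i j k h ≫ (braidHom X Y k ≫ braidHom Y X k) = ιTensorObj X Y i j k h ≫ 𝟙 _
  rw [reassoc_of% (ι_braidHom X Y i j k h), units_smul_comp', assoc, ι_braidHom, comp_units_smul', smul_smul,
    mul_comm j i, Int.units_mul_self, one_smul, SymmetricCategory.symmetry_assoc, comp_id]

lemma koszul_natural {X Y X' Y' : GradedObject ℤ A} (f : X ⟶ X') (g : Y ⟶ Y') :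
    GradedObject.Monoidal.tensorHom f g ≫ braidHom X' Y' = braidHom X Y ≫ GradedObject.Monoidal.tensorHom g f := by
  ext k i j h
  change ιTensorObj X Y i j k h ≫ (_ ≫ _) = ιTensorObj X Y i j k h ≫ (_ ≫ _)
  rw [ι_tensorHom_assoc, ι_braidHom, reassoc_of% (ι_braidHom X Y i j k h), units_smul_comp', comp_units_smul', assoc, ι_tensorHom,
    BraidedCategory.braiding_naturality_assoc]

lemma ι₃_braidHom (X Y Z : GradedObject ℤ A) (i₁ i₂ i₃ k : ℤ) (h : i₁ + i₂ + i₃ = k) :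
    ιTensorObj₃ X Y Z i₁ i₂ i₃ k h ≫ braidHom X (GradedObject.Monoidal.tensorObj Y Z) k =
      (i₁ * (i₂ + i₃)).negOnePow • ((β_ _ _).hom ≫ ιTensorObj₃' Y Z X i₂ i₃ i₁ k (by omega)) := by
  rw [ιTensorObj₃_eq X Y Z i₁ i₂ i₃ k h _ rfl, assoc, ι_braidHom, comp_units_smul',
    BraidedCategory.braiding_naturality_right_assoc, ιTensorObj₃'_eq Y Z X i₂ i₃ i₁ k _ _ rfl]

lemma ι₃'_whiskerRight (X Y Z : GradedObject ℤ A) (i₁ i₂ i₃ k : ℤ) (h : i₁ + i₂ + i₃ = k) :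
    ιTensorObj₃' X Y Z i₁ i₂ i₃ k h ≫ GradedObject.Monoidal.whiskerRight (braidHom X Y) Z k =
      (i₁ * i₂).negOnePow • ((β_ _ _).hom ▷ _ ≫ ιTensorObj₃' Y X Z i₂ i₁ i₃ k (by omega)) := by
  have h1 := ι_tensorHom (braidHom X Y) (𝟙 Z) (i₁ + i₂) i₃ k h
  have h2 : braidHom X Y (i₁ + i₂) ⊗ₘ (𝟙 Z : Z ⟶ Z) i₃ = braidHom X Y (i₁ + i₂) ▷ Z i₃ :=
    MonoidalCategory.tensorHom_id _ _
  rw [h2] at h1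
  rw [ιTensorObj₃'_eq X Y Z i₁ i₂ i₃ k h _ rfl, assoc, h1, ιTensorObj₃'_eq Y X Z i₂ i₁ i₃ k _ _ (add_comm _ _),
    ← comp_whiskerRight_assoc, ι_braidHom,
    units_smul_whiskerRight, units_smul_comp', comp_whiskerRight_assoc]

lemma ι₃_whiskerLeft (X Y Z : GradedObject ℤ A) (i₁ i₂ i₃ k : ℤ) (h : i₁ + i₂ + i₃ = k) :
    ιTensorObj₃ X Y Z i₁ i₂ i₃ k h ≫ GradedObject.Monoidal.whiskerLeft X (braidHom Y Z) k =
      (i₂ * i₃).negOnePow • (_ ◁ (β_ _ _).hom ≫ ιTensorObj₃ X Z Y i₁ i₃ i₂ k (by omega)) := by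
  have h1 := ι_tensorHom (𝟙 X) (braidHom Y Z) i₁ (i₂ + i₃) k (by omega)
  have h2 : (𝟙 X : X ⟶ X) i₁ ⊗ₘ braidHom Y Z (i₂ + i₃) = X i₁ ◁ braidHom Y Z (i₂ + i₃) :=
    MonoidalCategory.id_tensorHom _ _
  rw [h2] at h1
  rw [ιTensorObj₃_eq X Y Z i₁ i₂ i₃ k h _ rfl, assoc, h1, ιTensorObj₃_eq X Z Y i₁ i₃ i₂ k _ _ (add_comm _ _),
    ← MonoidalCategory.whiskerLeft_comp_assoc, ι_braidHom,
    whiskerLeft_units_smul, units_smul_comp', MonoidalCategory.whiskerLeft_comp_assoc]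

lemma koszul_hexagon (X Y Z : GradedObject ℤ A) :
    (GradedObject.Monoidal.associator X Y Z).hom ≫ (braidHom X (GradedObject.Monoidal.tensorObj Y Z)) ≫ (GradedObject.Monoidal.associator Y Z X).hom =
      GradedObject.Monoidal.whiskerRight (braidHom X Y) Z ≫ (GradedObject.Monoidal.associator Y X Z).hom ≫
        GradedObject.Monoidal.whiskerLeft Y (braidHom X Z) := by
  ext k i₁ i₂ i₃ h
  change ιTensorObj₃' X Y Z i₁ i₂ i₃ k h ≫ ((GradedObject.Monoidal.associator X Y Z).hom k ≫
      braidHom X (GradedObject.Monoidal.tensorObj Y Z) k ≫ (GradedObject.Monoidal.associator Y Z X).hom k) =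
    ιTensorObj₃' X Y Z i₁ i₂ i₃ k h ≫ (GradedObject.Monoidal.whiskerRight (braidHom X Y) Z k ≫
      (GradedObject.Monoidal.associator Y X Z).hom k ≫ GradedObject.Monoidal.whiskerLeft Y (braidHom X Z) k)
  have e1 := ιTensorObj₃'_associator_hom X Y Z i₁ i₂ i₃ k h
  have e2 := ιTensorObj₃'_associator_hom Y Z X i₂ i₃ i₁ k (by omega)
  have e3 := ιTensorObj₃'_associator_hom Y X Z i₂ i₁ i₃ k (by omega)
  rw [reassoc_of% e1, reassoc_of% (ι₃_braidHom X Y Z i₁ i₂ i₃ k h), units_smul_comp', assoc, e2,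
    comp_units_smul', reassoc_of% (ι₃'_whiskerRight X Y Z i₁ i₂ i₃ k h), units_smul_comp', assoc, reassoc_of% e3,
    ι₃_whiskerLeft, comp_units_smul', comp_units_smul', smul_smul, mul_add, Int.negOnePow_add,
    BraidedCategory.hexagon_forward_assoc]

/-- The braiding of graded objects, as an isomorphism. -/
def braidIso (X Y : GradedObject ℤ A) : GradedObject.Monoidal.tensorObj X Y ≅ GradedObject.Monoidal.tensorObj Y X where
  hom := braidHom X Y
  inv := braidHom Y X
  hom_inv_id := koszul_symm X Y
  inv_hom_id := koszul_symm Y X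

/-- The braided category of graded objects, with the Koszul sign rule. -/
@[reducible]
def koszulBraided : BraidedCategory (GradedObject ℤ A) where
  braiding X Y := braidIso X Y
  braiding_naturality_left f Z := koszul_natural f (𝟙 Z)
  braiding_naturality_right Z _ _ f := koszul_natural (𝟙 Z) f
  hexagon_forward := koszul_hexagon
  hexagon_reverse X Y Z := by
    have h : (α_ Z X Y ≪≫ braidIso Z (X ⊗ Y) ≪≫ α_ X Y Z) =
      (whiskerRightIso (braidIso Z X) Y ≪≫ α_ X Z Y ≪≫ whiskerLeftIso X (braidIso Z Y)) :=
      Iso.ext (koszul_hexagon Z X Y)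
    have := congrArg Iso.inv h
    simp only [Iso.trans_inv, whiskerRightIso_inv, whiskerLeftIso_inv, assoc] at this
    exact this

/-- The degree `n` part of the braiding of chain complexes. -/
def braidX (K L : ChainComplex A ℤ) (n : ℤ) :
    (HomologicalComplex.tensorObj K L).X n ⟶ (HomologicalComplex.tensorObj L K).X n :=
  braidHom K.X L.X n

lemma ι_braidX (K L : ChainComplex A ℤ) (i j k : ℤ) (h : i + j = k) :
    HomologicalComplex.ιTensorObj K L i j k h ≫ braidX K L k =
      (i * j).negOnePow • ((β_ (K.X i) (L.X j)).hom ≫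
        HomologicalComplex.ιTensorObj L K j i k ((add_comm j i).trans h)) :=
  ι_braidHom K.X L.X i j k h

/-- The Leibniz rule: `d (x ⊗ y) = d x ⊗ y + (-1) ^ p • x ⊗ d y` on a summand `K_p ⊗ L_q`. -/
lemma ι_d (K L : ChainComplex A ℤ) (p q p' q' n n' : ℤ) (h : p + q = n) (hp : p' + 1 = p) (hq : q' + 1 = q)
    (hn : n' + 1 = n) :
    HomologicalComplex.ιTensorObj K L p q n h ≫ (HomologicalComplex.tensorObj K L).d n n' =
      K.d p p' ▷ L.X q ≫ HomologicalComplex.ιTensorObj K L p' q n' (by omega) +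
      p.negOnePow • (K.X p ◁ L.d q q' ≫ HomologicalComplex.ιTensorObj K L p q' n' (by omega)) := by
  rw [HomologicalComplex.mapBifunctor.d_eq, Preadditive.comp_add]
  erw [HomologicalComplex.mapBifunctor.ι_D₁, HomologicalComplex.mapBifunctor.ι_D₂]
  rw [HomologicalComplex.mapBifunctor.d₁_eq K L (curriedTensor A) (ComplexShape.down ℤ)
    (i₁ := p) (i₁' := p') hp q n' (show p' + q = n' by omega),
    HomologicalComplex.mapBifunctor.d₂_eq K L (curriedTensor A) (ComplexShape.down ℤ)
    p (i₂ := q) (i₂' := q') hq n' (show p + q' = n' by omega)]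
  congr 1
  exact one_smul _ _

lemma braidX_comm (K L : ChainComplex A ℤ) (i j : ℤ) (hij : (ComplexShape.down ℤ).Rel i j) :
    braidX K L i ≫ (HomologicalComplex.tensorObj L K).d i j =
      (HomologicalComplex.tensorObj K L).d i j ≫ braidX K L j := by
  obtain rfl : i = j + 1 := hij.symm
  apply HomologicalComplex.mapBifunctor.hom_ext
  intro p q (hpq : p + q = j + 1)
  have e1 : (p * (q - 1)).negOnePow = (p * q).negOnePow * p.negOnePow := by
    rw [mul_sub, mul_one, Int.negOnePow_sub]
  have e2 : ((p - 1) * q).negOnePow = (p * q).negOnePow * q.negOnePow := by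
    rw [sub_mul, one_mul, Int.negOnePow_sub]
  have h1 := ι_braidX K L p q (j + 1) hpq
  have h2 := ι_d K L p q (p - 1) (q - 1) (j + 1) j hpq (by omega) (by omega) rfl
  have h3 := ι_d L K q p (q - 1) (p - 1) (j + 1) j (by omega) (by omega) (by omega) rfl
  have h4 := ι_braidX K L (p - 1) q j (by omega)
  have h5 := ι_braidX K L p (q - 1) j (by omega)
  rw [reassoc_of% h1, reassoc_of% h2, units_smul_comp', assoc, h3, Preadditive.add_comp, units_smul_comp',
    assoc, assoc, h4, h5, Preadditive.comp_add, comp_units_smul', comp_units_smul', comp_units_smul',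
    smul_smul, e1, e2, mul_comm (p * q).negOnePow p.negOnePow, ← mul_assoc, Int.units_mul_self, one_mul, smul_add, smul_smul,
    BraidedCategory.braiding_naturality_left_assoc, BraidedCategory.braiding_naturality_right_assoc, add_comm]

end KoszulBraiding
open KoszulBraiding

/-- The braiding of chain complexes, with the Koszul sign rule. The tensor product of chain complexes
is Mathlib's: `(K ⊗ L)_n` is the direct sum of the `K_p ⊗ L_q` with `p + q = n`. -/
def chainBraiding (K L : ChainComplex A ℤ) : K ⊗ L ≅ L ⊗ K :=
  HomologicalComplex.Hom.isoOfComponents (fun n => (GradedObject.eval n).mapIso (braidIso K.X L.X))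
    (fun i j h => braidX_comm K L i j h)

instance chainBraided : BraidedCategory (ChainComplex A ℤ) :=
  letI : BraidedCategory (GradedObject ℤ A) := koszulBraided
  letI : (HomologicalComplex.forget A (ComplexShape.down ℤ)).Monoidal :=
    Monoidal.fromInducedMonoidal _ (HomologicalComplex.Monoidal.inducingFunctorData A (ComplexShape.down ℤ))
  BraidedCategory.ofFaithful (HomologicalComplex.forget A (ComplexShape.down ℤ)) chainBraiding (by
    intro X Y
    refine (Category.id_comp _).trans (Category.comp_id _).symm)

instance chainSymmetric : SymmetricCategory (ChainComplex A ℤ) where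
  symmetry X Y := by
    ext n : 1
    exact congrFun (koszul_symm X.X Y.X) n

/-! ### The `A`-enriched category of chain complexes -/

section ChainHom

open MonoidalClosed (pre)
open scoped MonoidalClosed

/-- The object `∏ₙ [X_n, Y_n]` of degree `0` maps of graded objects. -/
abbrev gradedHom (X Y : ChainComplex A ℤ) : A :=
  ∏ᶜ fun n : ℤ => (ihom (X.X n)).obj (Y.X n)

/-- The differential of the internal Hom complex in degree `0`, `f ↦ d_Y ∘ f - f ∘ d_X`. -/
def chainHomDiff (X Y : ChainComplex A ℤ) :
    gradedHom X Y ⟶ ∏ᶜ fun n : ℤ => (ihom (X.X n)).obj (Y.X (n - 1)) :=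
  Pi.lift fun n =>
    Pi.π (fun n : ℤ => (ihom (X.X n)).obj (Y.X n)) n ≫ (ihom (X.X n)).map (Y.d n (n - 1)) -
      Pi.π (fun n : ℤ => (ihom (X.X n)).obj (Y.X n)) (n - 1) ≫
        (pre (X.d n (n - 1))).app (Y.X (n - 1))

lemma chainHomDiff_π (X Y : ChainComplex A ℤ) (n : ℤ) :
    chainHomDiff X Y ≫ Pi.π (fun n : ℤ => (ihom (X.X n)).obj (Y.X (n - 1))) n =
      Pi.π (fun n : ℤ => (ihom (X.X n)).obj (Y.X n)) n ≫ (ihom (X.X n)).map (Y.d n (n - 1)) -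
        Pi.π (fun n : ℤ => (ihom (X.X n)).obj (Y.X n)) (n - 1) ≫
          (pre (X.d n (n - 1))).app (Y.X (n - 1)) := by
  simp [chainHomDiff]

/-- The object of `A` of chain maps from `X` to `Y`: the `0`-cycles of the internal Hom complex. -/
abbrev chainHom (X Y : ChainComplex A ℤ) : A := kernel (chainHomDiff X Y)

/-- The map `ev_n`, `f ↦ f_n`. -/
def chainHomEv (X Y : ChainComplex A ℤ) (n : ℤ) : chainHom X Y ⟶ (ihom (X.X n)).obj (Y.X n) :=
  kernel.ι (chainHomDiff X Y) ≫ Pi.π (fun n : ℤ => (ihom (X.X n)).obj (Y.X n)) n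

lemma chainHom_ext {T : A} {X Y : ChainComplex A ℤ} {f g : T ⟶ chainHom X Y}
    (h : ∀ n, f ≫ chainHomEv X Y n = g ≫ chainHomEv X Y n) : f = g := by
  refine (cancel_mono (kernel.ι (chainHomDiff X Y))).1 ?_
  apply Pi.hom_ext
  intro n
  have := h n
  simp only [chainHomEv, ← assoc] at this
  exact this

lemma chainHomEv_comm (X Y : ChainComplex A ℤ) (n m : ℤ) :
    chainHomEv X Y n ≫ (ihom (X.X n)).map (Y.d n m) =
      chainHomEv X Y m ≫ (pre (X.d n m)).app (Y.X m) := by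
  by_cases h : (ComplexShape.down ℤ).Rel n m
  · obtain rfl : m = n - 1 := eq_sub_of_add_eq h
    have := kernel.condition (chainHomDiff X Y) =≫ Pi.π _ n
    rw [zero_comp, assoc, chainHomDiff_π, Preadditive.comp_sub, sub_eq_zero] at this
    simp only [chainHomEv, assoc]
    exact this
  · apply MonoidalClosed.uncurry_injective
    rw [MonoidalClosed.uncurry_natural_right, MonoidalClosed.uncurry_pre_app,
      Y.shape _ _ h, X.shape _ _ h, comp_zero, MonoidalPreadditive.zero_whiskerRight, zero_comp]

/-- The universal property of `chainHom X Y`. -/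
def chainHomLift {T : A} {X Y : ChainComplex A ℤ} (f : ∀ n, T ⟶ (ihom (X.X n)).obj (Y.X n))
    (hf : ∀ n m, (ComplexShape.down ℤ).Rel n m →
      f n ≫ (ihom (X.X n)).map (Y.d n m) = f m ≫ (pre (X.d n m)).app (Y.X m)) :
    T ⟶ chainHom X Y :=
  kernel.lift _ (Pi.lift f) (by
    apply Pi.hom_ext
    intro n
    have h : (ComplexShape.down ℤ).Rel n (n - 1) := sub_add_cancel n 1
    rw [zero_comp, assoc, chainHomDiff_π, Preadditive.comp_sub, Pi.lift_π_assoc,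
      Pi.lift_π_assoc, hf n (n - 1) h, sub_self])

lemma chainHomLift_ev {T : A} {X Y : ChainComplex A ℤ} (f : ∀ n, T ⟶ (ihom (X.X n)).obj (Y.X n))
    (hf) (n : ℤ) : chainHomLift f hf ≫ chainHomEv X Y n = f n := by
  simp [chainHomLift, chainHomEv]

lemma ihomComp_map (X Y Z Z' : A) (g : Z ⟶ Z') :
    MonoidalClosed.comp X Y Z ≫ (ihom X).map g =
      _ ◁ (ihom Y).map g ≫ MonoidalClosed.comp X Y Z' := by
  have := eComp_eHomWhiskerLeft A X Y g
  rwa [MonoidalClosed.enrichedOrdinaryCategorySelf_eHomWhiskerLeft,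
    MonoidalClosed.enrichedOrdinaryCategorySelf_eHomWhiskerLeft] at this

lemma ihomComp_pre (X X' Y Z : A) (f : X ⟶ X') :
    MonoidalClosed.comp X' Y Z ≫ (pre f).app Z = (pre f).app Y ▷ _ ≫ MonoidalClosed.comp X Y Z := by
  have := eComp_eHomWhiskerRight A f Y Z
  rwa [MonoidalClosed.enrichedOrdinaryCategorySelf_eHomWhiskerRight,
    MonoidalClosed.enrichedOrdinaryCategorySelf_eHomWhiskerRight] at this

lemma ihomComp_middle (X Y Y' Z : A) (f : Y ⟶ Y') :
    _ ◁ (pre f).app Z ≫ MonoidalClosed.comp X Y Z =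
      (ihom X).map f ▷ _ ≫ MonoidalClosed.comp X Y' Z := by
  have : _ ◁ eHomWhiskerRight A f Z ≫ eComp A X Y Z =
      eHomWhiskerLeft A X f ▷ _ ≫ eComp A X Y' Z := by
    dsimp [eHomWhiskerLeft, eHomWhiskerRight]
    simp only [MonoidalCategory.whiskerLeft_comp_assoc, whisker_assoc_symm,
      triangle_assoc_comp_left_inv_assoc, e_assoc', assoc, comp_whiskerRight]
  rwa [MonoidalClosed.enrichedOrdinaryCategorySelf_eHomWhiskerRight,
    MonoidalClosed.enrichedOrdinaryCategorySelf_eHomWhiskerLeft] at this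

/-- The identity, as an element of `chainHom X X`. -/
def chainHomId (X : ChainComplex A ℤ) : 𝟙_ A ⟶ chainHom X X :=
  chainHomLift (fun n => MonoidalClosed.id (X.X n)) (by
    intro n m _
    apply MonoidalClosed.uncurry_injective
    rw [MonoidalClosed.uncurry_natural_right, MonoidalClosed.uncurry_pre_app, MonoidalClosed.id_eq,
      MonoidalClosed.id_eq, MonoidalClosed.uncurry_curry, MonoidalClosed.uncurry_curry,
      MonoidalCategory.rightUnitor_naturality])

/-- The composition `chainHom X Y ⊗ chainHom Y Z ⟶ chainHom X Z`. -/
def chainHomComp (X Y Z : ChainComplex A ℤ) : chainHom X Y ⊗ chainHom Y Z ⟶ chainHom X Z :=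
  chainHomLift (fun n => (chainHomEv X Y n ⊗ₘ chainHomEv Y Z n) ≫
      MonoidalClosed.comp (X.X n) (Y.X n) (Z.X n)) (by
    intro n m _
    rw [assoc, assoc, ihomComp_map, ihomComp_pre, ← id_tensorHom, ← tensorHom_id,
      tensorHom_comp_tensorHom_assoc, tensorHom_comp_tensorHom_assoc, comp_id, comp_id,
      chainHomEv_comm, ← chainHomEv_comm X Y, ← tensorHom_comp_whiskerLeft_assoc,
      ihomComp_middle, tensorHom_comp_whiskerRight_assoc])


lemma chainHomComp_ev (X Y Z : ChainComplex A ℤ) (n : ℤ) :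
    chainHomComp X Y Z ≫ chainHomEv X Z n = (chainHomEv X Y n ⊗ₘ chainHomEv Y Z n) ≫
      MonoidalClosed.comp (X.X n) (Y.X n) (Z.X n) :=
  chainHomLift_ev _ _ _

lemma chainHomId_ev (X : ChainComplex A ℤ) (n : ℤ) :
    chainHomId X ≫ chainHomEv X X n = MonoidalClosed.id (X.X n) :=
  chainHomLift_ev _ _ _

/-- The `A`-enriched category of chain complexes in `A`. -/
instance chainEnriched : EnrichedCategory A (ChainComplex A ℤ) where
  Hom := chainHom
  id := chainHomId
  comp := chainHomComp
  id_comp X Y := by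
    apply chainHom_ext
    intro n
    rw [assoc, assoc, chainHomComp_ev, ← tensorHom_id, tensorHom_comp_tensorHom_assoc,
      chainHomId_ev, Category.id_comp, MonoidalCategory.tensorHom_def',
      assoc, ← leftUnitor_inv_naturality_assoc, MonoidalClosed.id_comp, Category.comp_id]
  comp_id X Y := by
    apply chainHom_ext
    intro n
    rw [assoc, assoc, chainHomComp_ev, ← id_tensorHom, tensorHom_comp_tensorHom_assoc,
      chainHomId_ev, Category.id_comp, MonoidalCategory.tensorHom_def,
      assoc, ← rightUnitor_inv_naturality_assoc, MonoidalClosed.comp_id, Category.comp_id]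
  assoc W X Y Z := by
    apply chainHom_ext
    intro n
    rw [assoc, assoc, assoc, chainHomComp_ev, ← id_tensorHom, ← tensorHom_id,
      chainHomComp_ev, tensorHom_comp_tensorHom_assoc,
      tensorHom_comp_tensorHom_assoc, chainHomComp_ev, chainHomComp_ev,
      Category.id_comp, Category.id_comp, ← tensorHom_comp_whiskerRight_assoc,
      ← tensorHom_comp_whiskerLeft_assoc, ← associator_inv_naturality_assoc, MonoidalClosed.assoc]

/-- The element of `chainHom X Y` given by a chain map. -/
def chainHomOfHom {X Y : ChainComplex A ℤ} (f : X ⟶ Y) : 𝟙_ A ⟶ chainHom X Y :=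
  chainHomLift (fun n => MonoidalClosed.curry' (f.f n)) (by
    intro n m _
    apply MonoidalClosed.uncurry_injective
    rw [MonoidalClosed.uncurry_natural_right, MonoidalClosed.uncurry_pre_app, MonoidalClosed.curry',
      MonoidalClosed.curry', MonoidalClosed.uncurry_curry, MonoidalClosed.uncurry_curry, assoc,
      f.comm, MonoidalCategory.rightUnitor_naturality_assoc])

lemma chainHomOfHom_ev {X Y : ChainComplex A ℤ} (f : X ⟶ Y) (n : ℤ) :
    chainHomOfHom f ≫ chainHomEv X Y n = MonoidalClosed.curry' (f.f n) :=
  chainHomLift_ev _ _ _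

/-- The chain map given by an element of `chainHom X Y`. -/
def homOfChainHom {X Y : ChainComplex A ℤ} (g : 𝟙_ A ⟶ chainHom X Y) : X ⟶ Y where
  f n := MonoidalClosed.uncurry' (g ≫ chainHomEv X Y n)
  comm' n m _ := by
    have h := g ≫= chainHomEv_comm X Y n m
    rw [← assoc, ← assoc] at h
    have h2 := congrArg MonoidalClosed.uncurry h
    rw [MonoidalClosed.uncurry_natural_right, MonoidalClosed.uncurry_pre_app] at h2
    rw [MonoidalClosed.uncurry', MonoidalClosed.uncurry', assoc, h2,
      MonoidalCategory.rightUnitor_inv_naturality_assoc]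

/-- The underlying category of this enriched category is the category of chain complexes. -/
instance chainEnrichedOrdinary : EnrichedOrdinaryCategory A (ChainComplex A ℤ) where
  homEquiv {X Y} :=
    { toFun := chainHomOfHom
      invFun := homOfChainHom
      left_inv := fun f => by
        ext n
        change MonoidalClosed.uncurry' (chainHomOfHom f ≫ chainHomEv X Y n) = _
        rw [chainHomOfHom_ev, MonoidalClosed.uncurry'_curry']
      right_inv := fun g => by
        apply chainHom_ext
        intro n
        rw [chainHomOfHom_ev]
        exact MonoidalClosed.curry'_uncurry' _ }
  homEquiv_id X := by
    apply chainHom_ext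
    intro n
    refine (chainHomOfHom_ev _ _).trans (Eq.trans ?_ (chainHomId_ev _ _).symm)
    exact MonoidalClosed.curry'_id _
  homEquiv_comp {X Y Z} f g := by
    apply chainHom_ext
    intro n
    refine (chainHomOfHom_ev _ _).trans ?_
    change _ = ((λ_ (𝟙_ A)).inv ≫ (chainHomOfHom f ⊗ₘ chainHomOfHom g) ≫ chainHomComp X Y Z) ≫ _
    rw [assoc, assoc, chainHomComp_ev, tensorHom_comp_tensorHom_assoc, chainHomOfHom_ev,
      chainHomOfHom_ev]
    exact MonoidalClosed.curry'_comp _ _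

/-- The morphism `[X, Y] ⊗ [Z, T] ⟶ [X ⊗ Z, Y ⊗ T]`, `(f, g) ↦ f ⊗ g`. -/
def ihomTensor (X Y Z T : A) :
    (ihom X).obj Y ⊗ (ihom Z).obj T ⟶ (ihom (X ⊗ Z)).obj (Y ⊗ T) :=
  MonoidalClosed.curry (tensorμ X Z ((ihom X).obj Y) ((ihom Z).obj T) ≫
    ((ihom.ev X).app Y ⊗ₘ (ihom.ev Z).app T))

lemma ihomTensor_pre {X X' Z Z' : A} (f : X ⟶ X') (g : Z ⟶ Z') (Y T : A) :
    ihomTensor X' Y Z' T ≫ (pre (f ⊗ₘ g)).app (Y ⊗ T) =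
      ((pre f).app Y ⊗ₘ (pre g).app T) ≫ ihomTensor X Y Z T := by
  apply MonoidalClosed.uncurry_injective
  rw [MonoidalClosed.uncurry_pre_app, MonoidalClosed.uncurry_natural_left, ihomTensor, ihomTensor,
    MonoidalClosed.uncurry_curry, MonoidalClosed.uncurry_curry,
    tensorμ_natural_left_assoc, tensorμ_natural_right_assoc, tensorHom_comp_tensorHom,
    tensorHom_comp_tensorHom, MonoidalClosed.id_tensor_pre_app_comp_ev,
    MonoidalClosed.id_tensor_pre_app_comp_ev]

lemma ihomTensor_map (X Z : A) {Y Y' T T' : A} (f : Y ⟶ Y') (g : T ⟶ T') :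
    ihomTensor X Y Z T ≫ (ihom (X ⊗ Z)).map (f ⊗ₘ g) =
      ((ihom X).map f ⊗ₘ (ihom Z).map g) ≫ ihomTensor X Y' Z T' := by
  apply MonoidalClosed.uncurry_injective
  rw [MonoidalClosed.uncurry_natural_right, MonoidalClosed.uncurry_natural_left, ihomTensor,
    ihomTensor, MonoidalClosed.uncurry_curry, MonoidalClosed.uncurry_curry,
    tensorμ_natural_right_assoc, assoc, tensorHom_comp_tensorHom, tensorHom_comp_tensorHom,
    ihom.ev_naturality, ihom.ev_naturality]

lemma pre_app_add {X X' : A} (f g : X ⟶ X') (Y : A) :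
    (pre (f + g)).app Y = (pre f).app Y + (pre g).app Y := by
  apply MonoidalClosed.uncurry_injective
  rw [MonoidalClosed.uncurry_pre, MonoidalPreadditive.add_whiskerRight, Preadditive.add_comp,
    MonoidalClosed.uncurry_eq, MonoidalPreadditive.whiskerLeft_add, Preadditive.add_comp,
    MonoidalClosed.id_tensor_pre_app_comp_ev, MonoidalClosed.id_tensor_pre_app_comp_ev]

lemma pre_app_units_smul (r : ℤˣ) {X X' : A} (f : X ⟶ X') (Y : A) :
    (pre (r • f)).app Y = r • (pre f).app Y := by
  apply MonoidalClosed.uncurry_injective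
  rw [MonoidalClosed.uncurry_pre, MonoidalClosed.uncurry_eq,
    KoszulBraiding.units_smul_whiskerRight, KoszulBraiding.whiskerLeft_units_smul,
    KoszulBraiding.units_smul_comp', KoszulBraiding.units_smul_comp',
    MonoidalClosed.id_tensor_pre_app_comp_ev]

lemma ihom_map_add (X : A) {Y Y' : A} (f g : Y ⟶ Y') :
    (ihom X).map (f + g) = (ihom X).map f + (ihom X).map g := by
  apply MonoidalClosed.uncurry_injective
  rw [MonoidalClosed.uncurry_ihom_map, MonoidalClosed.uncurry_eq, MonoidalPreadditive.whiskerLeft_add,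
    Preadditive.add_comp, ihom.ev_naturality, ihom.ev_naturality, Preadditive.comp_add]

lemma ihom_map_units_smul (X : A) (r : ℤˣ) {Y Y' : A} (f : Y ⟶ Y') :
    (ihom X).map (r • f) = r • (ihom X).map f := by
  apply MonoidalClosed.uncurry_injective
  rw [MonoidalClosed.uncurry_ihom_map, MonoidalClosed.uncurry_eq (g := r • (ihom X).map f),
    KoszulBraiding.whiskerLeft_units_smul, KoszulBraiding.units_smul_comp',
    KoszulBraiding.comp_units_smul', ihom.ev_naturality]

lemma ihomTensor_dinatural {P Q X X' Y Y' Z Z' T T' W : A}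
    {a : P ⟶ (ihom X).obj Y} {a' : P ⟶ (ihom X').obj Y'} {b : Q ⟶ (ihom Z).obj T}
    {b' : Q ⟶ (ihom Z').obj T'} {f : X ⟶ X'} {g : Y ⟶ Y'} {h : Z ⟶ Z'} {t : T ⟶ T'}
    (ha : a ≫ (ihom X).map g = a' ≫ (pre f).app Y') (hb : b ≫ (ihom Z).map t = b' ≫ (pre h).app T')
    (i : Y' ⊗ T' ⟶ W) :
    (a ⊗ₘ b) ≫ ihomTensor X Y Z T ≫ (ihom (X ⊗ Z)).map (g ⊗ₘ t) ≫ (ihom (X ⊗ Z)).map i =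
      (a' ⊗ₘ b') ≫ ihomTensor X' Y' Z' T' ≫ (ihom (X' ⊗ Z')).map i ≫ (pre (f ⊗ₘ h)).app W := by
  rw [← MonoidalClosed.pre_comm_ihom_map, reassoc_of% (ihomTensor_map X Z g t),
    reassoc_of% (ihomTensor_pre f h Y' T'), tensorHom_comp_tensorHom_assoc,
    tensorHom_comp_tensorHom_assoc, ha, hb]

/-- The bijection between morphisms `P ⟶ [S, W]` and morphisms `S ⟶ [P, W]`. -/
def ihomFlip {P S W : A} (f : P ⟶ (ihom S).obj W) : S ⟶ (ihom P).obj W :=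
  MonoidalClosed.curry ((β_ P S).hom ≫ MonoidalClosed.uncurry f)

lemma ihomFlip_ihomFlip {P S W : A} (f : P ⟶ (ihom S).obj W) : ihomFlip (ihomFlip f) = f := by
  simp [ihomFlip]

lemma ihomFlip_comp {P S S' W : A} (s : S' ⟶ S) (f : S ⟶ (ihom P).obj W) :
    ihomFlip (s ≫ f) = ihomFlip f ≫ (pre s).app W := by
  apply MonoidalClosed.uncurry_injective
  rw [MonoidalClosed.uncurry_pre_app, ihomFlip, ihomFlip, MonoidalClosed.uncurry_curry,
    MonoidalClosed.uncurry_curry, MonoidalClosed.uncurry_natural_left,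
    BraidedCategory.braiding_naturality_left_assoc]

section

open HomologicalComplex (ιTensorObj)

/-- The degree `n` component of `f ⊗ g`, given on the summand `X_k ⊗ Z_l` by `f_k ⊗ g_l`. -/
def chainHomTensorX (X Y Z T : ChainComplex A ℤ) (n : ℤ) :
    chainHom X Y ⊗ chainHom Z T ⟶ (ihom ((X ⊗ Z).X n)).obj ((Y ⊗ T).X n) :=
  ihomFlip (HomologicalComplex.mapBifunctorDesc fun k l (h : k + l = n) =>
    ihomFlip ((chainHomEv X Y k ⊗ₘ chainHomEv Z T l) ≫
      ihomTensor (X.X k) (Y.X k) (Z.X l) (T.X l) ≫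
      (ihom (X.X k ⊗ Z.X l)).map (ιTensorObj Y T k l n h)))

lemma chainHomTensorX_pre (X Y Z T : ChainComplex A ℤ) (k l n : ℤ) (h : k + l = n) :
    chainHomTensorX X Y Z T n ≫ (pre (ιTensorObj X Z k l n h)).app _ =
      (chainHomEv X Y k ⊗ₘ chainHomEv Z T l) ≫ ihomTensor (X.X k) (Y.X k) (Z.X l) (T.X l) ≫
      (ihom (X.X k ⊗ Z.X l)).map (ιTensorObj Y T k l n h) := by
  rw [chainHomTensorX, ← ihomFlip_comp]
  erw [HomologicalComplex.ι_mapBifunctorDesc]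
  rw [ihomFlip_ihomFlip]

lemma ihom_tensor_ext {P W : A} (X Z : ChainComplex A ℤ) (n : ℤ)
    {f g : P ⟶ (ihom ((X ⊗ Z).X n)).obj W}
    (h : ∀ k l (h : k + l = n), f ≫ (pre (ιTensorObj X Z k l n h)).app W =
      g ≫ (pre (ιTensorObj X Z k l n h)).app W) : f = g := by
  rw [← ihomFlip_ihomFlip f, ← ihomFlip_ihomFlip g]
  congr 1
  apply HomologicalComplex.mapBifunctor.hom_ext
  intro k l hkl
  have := congrArg ihomFlip (h k l hkl)
  rw [← ihomFlip_ihomFlip f, ← ihomFlip_ihomFlip g, ← ihomFlip_comp, ← ihomFlip_comp,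
    ihomFlip_ihomFlip, ihomFlip_ihomFlip] at this
  exact this

/-- The tensor product of elements of `chainHom`, `(f, g) ↦ f ⊗ g`. -/
def chainHomTensor (X Y Z T : ChainComplex A ℤ) :
    chainHom X Y ⊗ chainHom Z T ⟶ chainHom (X ⊗ Z) (Y ⊗ T) :=
  chainHomLift (chainHomTensorX X Y Z T) (by
    intro n m (hnm : m + 1 = n)
    apply ihom_tensor_ext
    intro k l h
    have h1 := KoszulBraiding.ι_d X Z k l (k - 1) (l - 1) n m h (by omega) (by omega) hnm
    have h2 := KoszulBraiding.ι_d Y T k l (k - 1) (l - 1) n m h (by omega) (by omega) hnm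
    have e1 : chainHomTensorX X Y Z T n ≫ (ihom _).map ((HomologicalComplex.tensorObj Y T).d n m) ≫
        (pre (ιTensorObj X Z k l n h)).app _ =
        (chainHomEv X Y k ⊗ₘ chainHomEv Z T l) ≫ ihomTensor (X.X k) (Y.X k) (Z.X l) (T.X l) ≫
          (ihom (X.X k ⊗ Z.X l)).map (ιTensorObj Y T k l n h ≫
            (HomologicalComplex.tensorObj Y T).d n m) := by
      rw [← MonoidalClosed.pre_comm_ihom_map, reassoc_of% chainHomTensorX_pre, Functor.map_comp]
    have e2 : chainHomTensorX X Y Z T m ≫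
        (pre ((HomologicalComplex.tensorObj X Z).d n m)).app ((Y ⊗ T).X m) ≫
        (pre (ιTensorObj X Z k l n h)).app ((Y ⊗ T).X m) =
        chainHomTensorX X Y Z T m ≫ (pre (ιTensorObj X Z k l n h ≫
          (HomologicalComplex.tensorObj X Z).d n m)).app ((Y ⊗ T).X m) := by
      rw [MonoidalClosed.pre_map, NatTrans.comp_app]
    have e3 := chainHomTensorX_pre X Y Z T (k - 1) l m (by omega)
    have e4 := chainHomTensorX_pre X Y Z T k (l - 1) m (by omega)
    refine (assoc _ _ _).trans (e1.trans (Eq.trans ?_ (e2.symm.trans (assoc _ _ _).symm)))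
    rw [h1, h2, ihom_map_add, ihom_map_units_smul, Functor.map_comp, Functor.map_comp,
      pre_app_add, pre_app_units_smul, MonoidalClosed.pre_map, MonoidalClosed.pre_map,
      NatTrans.comp_app, NatTrans.comp_app, Preadditive.comp_add, Preadditive.comp_add,
      Preadditive.comp_add, KoszulBraiding.comp_units_smul', KoszulBraiding.comp_units_smul',
      KoszulBraiding.comp_units_smul', reassoc_of% e3, reassoc_of% e4,
      ← tensorHom_id, ← id_tensorHom, ← tensorHom_id, ← id_tensorHom,
      ihomTensor_dinatural (chainHomEv_comm X Y k (k - 1)) (f := X.d k (k - 1)) (h := 𝟙 (Z.X l))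
        (b' := chainHomEv Z T l) (by simp),
      ihomTensor_dinatural (b' := chainHomEv Z T (l - 1)) (h := Z.d l (l - 1))
        (a' := chainHomEv X Y k) (f := 𝟙 (X.X k)) (by simp) (chainHomEv_comm Z T l (l - 1))]
    rfl)

end

end ChainHom

/-! ### Symmetric operads: structure maps and morphisms -/

section Operads

/-- The tensor product `P n₁ ⊗ (P n₂ ⊗ ⋯ ⊗ (P n_l ⊗ 𝟙))` for a list `[n₁, …, n_l]` of arities. -/
def opsTensor {V : Type*} [Category V] [MonoidalCategory V] (P : ℕ → V) : List ℕ → V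
  | [] => 𝟙_ V
  | n :: ns => P n ⊗ opsTensor P ns

/-- The tensor product `φ n₁ ⊗ ⋯ ⊗ φ n_l`. -/
def opsTensorMap {V : Type*} [Category V] [MonoidalCategory V] {P Q : ℕ → V}
    (φ : ∀ n, P n ⟶ Q n) : ∀ ns : List ℕ, opsTensor P ns ⟶ opsTensor Q ns
  | [] => 𝟙 _
  | n :: ns => φ n ⊗ₘ opsTensorMap φ ns

/-- The objects and structure maps of a symmetric operad in a monoidal category `V`: the objects of
operations of each arity, the (right) actions of the symmetric groups, the unit, and the
compositions `γ : P(l) ⊗ P(n₁) ⊗ ⋯ ⊗ P(n_l) ⟶ P(n₁ + ⋯ + n_l)`. The axioms of an operad do not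
intervene in the notion of a morphism, and are not recorded: only the structure
maps of the endomorphism operads below are used. -/
structure SymmetricOperadData (V : Type*) [Category V] [MonoidalCategory V] where
  obj : ℕ → V
  act {n : ℕ} (σ : Equiv.Perm (Fin n)) : obj n ⟶ obj n
  one : 𝟙_ V ⟶ obj 1
  comp (ns : List ℕ) : obj ns.length ⊗ opsTensor obj ns ⟶ obj ns.sum

/-- A family of maps `φ n : P(n) ⟶ Q(n)` is a morphism of symmetric operads when it is equivariant
and compatible with the units and with the compositions. -/
structure IsOperadMorphism {V : Type*} [Category V] [MonoidalCategory V]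
    (P Q : SymmetricOperadData V) (φ : ∀ n, P.obj n ⟶ Q.obj n) : Prop where
  act {n : ℕ} (σ : Equiv.Perm (Fin n)) : P.act σ ≫ φ n = φ n ≫ Q.act σ
  one : P.one ≫ φ 1 = Q.one
  comp (ns : List ℕ) :
    P.comp ns ≫ φ ns.sum = (φ ns.length ⊗ₘ opsTensorMap φ ns) ≫ Q.comp ns

end Operads

/-! ### Tensor powers -/

section TensorPowers

variable {C : Type*} [Category C] [MonoidalCategory C]

/-- The tensor power `X^{⊗ n} = ((𝟙 ⊗ X) ⊗ X) ⊗ ⋯ ⊗ X`. -/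
def tensorPow (X : C) : ℕ → C
  | 0 => 𝟙_ C
  | n + 1 => tensorPow X n ⊗ X

/-- The concatenation `X^{⊗ (m + n)} ≅ X^{⊗ m} ⊗ X^{⊗ n}`. -/
def tensorPowAdd (X : C) (m : ℕ) : ∀ n, tensorPow X (m + n) ≅ tensorPow X m ⊗ tensorPow X n
  | 0 => (ρ_ _).symm
  | n + 1 => whiskerRightIso (tensorPowAdd X m n) X ≪≫ α_ _ _ _

/-- The isomorphism `X ⊗ X^{⊗ n} ≅ X^{⊗ (n + 1)}`. -/
def tensorPowCons (X : C) : ∀ n, X ⊗ tensorPow X n ≅ tensorPow X (n + 1)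
  | 0 => ρ_ X ≪≫ (λ_ X).symm
  | n + 1 => (α_ _ _ _).symm ≪≫ whiskerRightIso (tensorPowCons X n) X

/-- The map `X^{⊗ n} ⊗ X ⟶ X^{⊗ (n + 1)}` which moves the last factor to position `p`, keeping the
order of the other factors. -/
def moveLast [BraidedCategory C] (X : C) :
    ∀ (n : ℕ) (_ : Fin (n + 1)), tensorPow X n ⊗ X ⟶ tensorPow X (n + 1)
  | 0, _ => 𝟙 _
  | n + 1, p => Fin.lastCases (motive := fun _ => tensorPow X (n + 1) ⊗ X ⟶ tensorPow X (n + 2))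
      (𝟙 _) (fun q => (α_ (tensorPow X n) X X).hom ≫ tensorPow X n ◁ (β_ X X).hom ≫
        (α_ (tensorPow X n) X X).inv ≫ moveLast X n q ▷ X) p

/-- The permutation of `Fin n` induced by a permutation `σ` of `Fin (n + 1)`, after deleting
`n` from the source and `σ n` from the target, and renumbering in increasing order. -/
def permInit {n : ℕ} (σ : Equiv.Perm (Fin (n + 1))) : Equiv.Perm (Fin n) :=
  Equiv.removeNone ((finSuccEquiv' (Fin.last n)).symm.trans
    (σ.trans (finSuccEquiv' (σ (Fin.last n)))))

/-- The automorphism of `X^{⊗ n}`, built from the braiding, which sends the factor in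
position `i` to the position `σ i`. -/
def tensorPowPerm [BraidedCategory C] (X : C) :
    ∀ {n : ℕ} (_ : Equiv.Perm (Fin n)), tensorPow X n ⟶ tensorPow X n
  | 0, _ => 𝟙 _
  | n + 1, σ => tensorPowPerm X (permInit σ) ▷ X ≫ moveLast X n (σ (Fin.last n))

end TensorPowers

/-! ### Endomorphism operads -/

section EndomorphismOperads

variable (V : Type*) [Category V] [MonoidalCategory V] {C : Type*} [Category C]
  [MonoidalCategory C] [EnrichedOrdinaryCategory V C]

/-- The tensor product `f₁ ⊗ ⋯ ⊗ f_l : X^{⊗ (n₁ + ⋯ + n_l)} ⟶ X^{⊗ l}` of the operations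
`f_i : X^{⊗ n_i} ⟶ X`. -/
def operationsTensor
    (tens : ∀ X Y Z T : C, (X ⟶[V] Y) ⊗ (Z ⟶[V] T) ⟶ ((X ⊗ Z) ⟶[V] (Y ⊗ T))) (X : C) :
    ∀ ns : List ℕ, opsTensor (fun n => tensorPow X n ⟶[V] X) ns ⟶
      (tensorPow X ns.sum ⟶[V] tensorPow X ns.length)
  | [] => eId V (𝟙_ C)
  | n :: ns => (_ ◁ operationsTensor tens X ns) ≫
      tens (tensorPow X n) X (tensorPow X ns.sum) (tensorPow X ns.length) ≫
      eHomWhiskerRight V (tensorPowAdd X n ns.sum).hom _ ≫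
      eHomWhiskerLeft V (tensorPow X (n + ns.sum)) (tensorPowCons X ns.length).hom

/-- The endomorphism operad `n ↦ (X^{⊗ n} ⟶[V] X)` of an object `X` of a symmetric monoidal category
`C` enriched in `V`; `tens` is the enriched tensor product `(f, g) ↦ f ⊗ g`. -/
def enrichedEndOperad [BraidedCategory V] [BraidedCategory C]
    (tens : ∀ X Y Z T : C, (X ⟶[V] Y) ⊗ (Z ⟶[V] T) ⟶ ((X ⊗ Z) ⟶[V] (Y ⊗ T))) (X : C) :
    SymmetricOperadData V where
  obj n := tensorPow X n ⟶[V] X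
  act σ := eHomWhiskerRight V (tensorPowPerm X σ) X
  one := eHomEquiv V (λ_ X).hom
  comp ns := (_ ◁ operationsTensor V tens X ns) ≫ (β_ _ _).hom ≫
    eComp V (tensorPow X ns.sum) (tensorPow X ns.length) X

end EndomorphismOperads

open scoped MonoidalClosed in
/-- The endomorphism operad `End(X)`, `End(X)_n = [X^{⊗ n}, X]`, of an object `X` of `A`. -/
def endOperad (X : A) : SymmetricOperadData A :=
  enrichedEndOperad A ihomTensor X

/-- The endomorphism operad `End^A(V)` of a chain complex `V`, an operad in `A` whose object of
`n`-ary operations is the object `chainHom (V^{⊗ n}) V` of chain maps. -/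
def chainEndOperad (V : ChainComplex A ℤ) : SymmetricOperadData A :=
  enrichedEndOperad A chainHomTensor V

/-! ### The map `⋊` -/

section Rtimes

open HomologicalComplex (ιTensorObj)

variable (V : ChainComplex A ℤ)

/-- The component `(V₁ ⊕ V₀)^{⊗ n} ⟶ (V^{⊗ n})₀` of `∂`. It is the identity
on the summand `V₀^{⊗ n}`, and zero on the words containing a copy of `V₁`. -/
def partialZero : ∀ n : ℕ, tensorPow (V.X 1 ⊞ V.X 0) n ⟶ (tensorPow V n).X 0
  | 0 => (HomologicalComplex.singleObjXSelf (ComplexShape.down ℤ) 0 (𝟙_ A)).inv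
  | n + 1 => (partialZero n ⊗ₘ biprod.snd) ≫ ιTensorObj (tensorPow V n) V 0 0 0 (add_zero 0)

/-- The component `(V₁ ⊕ V₀)^{⊗ n} ⟶ (V^{⊗ n})₁` of `∂`. It is zero on the
summand `V₀^{⊗ n}`, and on a word containing copies of `V₁` it applies `d` to all of them
except the leftmost one, and the identity to the copies of `V₀`. It is defined by recursion on the
length: if `w` contains a copy of `V₁`, then a letter `V₁` (resp. `V₀`) following `w` is
mapped by `d` (resp. by the identity); if `w` contains no copy of `V₁`, then a letter
`V₁` following `w` is the leftmost one, on which the map is the identity. -/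
def partialOne : ∀ n : ℕ, tensorPow (V.X 1 ⊞ V.X 0) n ⟶ (tensorPow V n).X 1
  | 0 => 0
  | n + 1 =>
      (partialOne n ⊗ₘ biprod.desc (V.d 1 0) (𝟙 (V.X 0))) ≫
        ιTensorObj (tensorPow V n) V 1 0 1 (add_zero 1) +
      (partialZero V n ⊗ₘ biprod.fst) ≫ ιTensorObj (tensorPow V n) V 0 1 1 (zero_add 1)

/-- The map `∂ : (V₁ ⊕ V₀)^{⊗ n} ⟶ (V^{⊗ n})₁ ⊕ (V^{⊗ n})₀`. -/
def partialMap (n : ℕ) :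
    tensorPow (V.X 1 ⊞ V.X 0) n ⟶ (tensorPow V n).X 1 ⊞ (tensorPow V n).X 0 :=
  biprod.lift (partialOne V n) (partialZero V n)

/-- The map `[X₁, Y₁] ⊕ [X₀, Y₀] ⟶ [X₁ ⊕ X₀, Y₁ ⊕ Y₀]`, `(f, g) ↦ f ⊕ g`. -/
def ihomDiag (X₁ Y₁ X₀ Y₀ : A) :
    (ihom X₁).obj Y₁ ⊞ (ihom X₀).obj Y₀ ⟶ (ihom (X₁ ⊞ X₀)).obj (Y₁ ⊞ Y₀) :=
  biprod.desc
    ((MonoidalClosed.pre biprod.fst).app Y₁ ≫ (ihom (X₁ ⊞ X₀)).map biprod.inl)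
    ((MonoidalClosed.pre biprod.snd).app Y₀ ≫ (ihom (X₁ ⊞ X₀)).map biprod.inr)

/-- The composite `[V^{⊗ n}, V] ⟶ [(V^{⊗ n})₁, V₁] ⊕ [(V^{⊗ n})₀, V₀] ⟶
[(V^{⊗ n})₁ ⊕ (V^{⊗ n})₀, V₁ ⊕ V₀] ⟶ [(V₁ ⊕ V₀)^{⊗ n}, V₁ ⊕ V₀]` of `(ev₁, ev₀)`, of the diagonal map
and of the precomposition with `∂`. -/
def rtimesMap (n : ℕ) : chainHom (tensorPow V n) V ⟶
    (ihom (tensorPow (V.X 1 ⊞ V.X 0) n)).obj (V.X 1 ⊞ V.X 0) :=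
  biprod.lift (chainHomEv (tensorPow V n) V 1) (chainHomEv (tensorPow V n) V 0) ≫
    ihomDiag ((tensorPow V n).X 1) (V.X 1) ((tensorPow V n).X 0) (V.X 0) ≫
    (MonoidalClosed.pre (partialMap V n)).app (V.X 1 ⊞ V.X 0)

/-- The map `⋊` in arity `n`: a chain map `f : V^{⊗ n} ⟶ V` is sent to
`(f₁ ⊕ f₀) ∘ ∂ : (V₁ ⊕ V₀)^{⊗ n} ⟶ V₁ ⊕ V₀`. -/
def rtimes (n : ℕ) : (chainEndOperad V).obj n ⟶ (endOperad (V.X 1 ⊞ V.X 0)).obj n :=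
  rtimesMap V n

end Rtimes

end

/-! Write `a₁`, `a₀` for the components `partialOne`, `partialZero` of `∂`, and `t = d a₁ + a₀` for
`partialTotal`. As `V₋₁ = 0`, the map `a₀` takes values in cycles, and the Leibniz rule shows that
`t` applies `d` to every letter `V₁` (`partialTotal_succ`).

Composition. In a concatenated word `uv`, either the leftmost `V₁` lies in `u`, or `u` has none and
it lies in `v`. Hence `a₀(uv) = a₀(u) ⊗ a₀(v)` and `a₁(uv) = a₁(u) ⊗ t(v) + a₀(u) ⊗ a₁(v)`
(`partialOne_tensorPowAdd`). Put `F = f₁ ⊗ ⋯ ⊗ f_l` and let `F'` be the tensor product of the `⋊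
fᵢ`. By induction on `l`, `a₁ F' = F₁ a₁` and `a₀ F' = F₀ a₀` (`rtimesOperationsTensor_map`); the
induction also needs `t F' = F₀ t`, which follows because `F` commutes with `d`. So `∂ F' = (F₁ ⊕
F₀) ∂`, and composing with `f₁ ⊕ f₀` gives `⋊ f ∘ F' = ⋊ (f ∘ F)`.

Equivariance. `∂` does not commute with permutations: exchanging two letters `x`, `y` of `V₁`, after
a word `w` without `V₁`, trades `w ⊗ x ⊗ dy` for `w ⊗ dx ⊗ y`. These differ by a boundary, up to
sign that of `w ⊗ x ⊗ y`. A chain map `f` to `V` satisfies `f₁ d = d f₂ = 0` since `V₂ = 0`, so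
commutation modulo boundaries is enough. This weaker property (`RestrictsModBoundaries`) holds for
adjacent swaps and is stable under composition and under `- ⊗ V`, hence holds for all permutations.
-/

noncomputable section

variable {A : Type u} [Category.{v} A] [Abelian A] [MonoidalCategory A]
  [SymmetricCategory A] [MonoidalClosed A] [HasLimits A] [HasColimits A]

/-! ### Maps into a summand of a tensor product of complexes -/

section TensorPair

open HomologicalComplex (ιTensorObj)

variable {K K' L L' M : ChainComplex A ℤ} {R S T : A} {i j k : ℤ}

/-- The map `a ⊗ b` into the summand `K_i ⊗ L_j` of `(K ⊗ L)_n`. -/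
def tensorPair (a : S ⟶ K.X i) (b : T ⟶ L.X j) (n : ℤ) (h : i + j = n) :
    S ⊗ T ⟶ (K ⊗ L).X n :=
  (a ⊗ₘ b) ≫ ιTensorObj K L i j n h

lemma ι_tensorHom_f (f : K ⟶ K') (g : L ⟶ L') (n : ℤ) (h : i + j = n) :
    ιTensorObj K L i j n h ≫ (f ⊗ₘ g).f n = (f.f i ⊗ₘ g.f j) ≫ ιTensorObj K' L' i j n h :=
  GradedObject.Monoidal.ι_tensorHom f.f g.f i j n h

lemma tensorPair_whiskerRight (a : S ⟶ K.X i) (b : T ⟶ L.X j) (n : ℤ) (h : i + j = n)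
    (f : K ⟶ K') : tensorPair a b n h ≫ (f ▷ L).f n = tensorPair (a ≫ f.f i) b n h := by
  rw [tensorPair, assoc, ← tensorHom_id, ι_tensorHom_f, tensorPair,
    tensorHom_comp_tensorHom_assoc]
  erw [comp_id]

lemma tensorPair_whiskerLeft (a : S ⟶ K.X i) (b : T ⟶ L.X j) (n : ℤ) (h : i + j = n)
    (f : L ⟶ L') : tensorPair a b n h ≫ (K ◁ f).f n = tensorPair a (b ≫ f.f j) n h := by
  rw [tensorPair, assoc, ← id_tensorHom, ι_tensorHom_f, tensorPair,
    tensorHom_comp_tensorHom_assoc]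
  erw [comp_id]

lemma comp_tensorPair {S' T' : A} (s : S' ⟶ S) (t : T' ⟶ T) (a : S ⟶ K.X i) (b : T ⟶ L.X j)
    (n : ℤ) (h : i + j = n) :
    (s ⊗ₘ t) ≫ tensorPair a b n h = tensorPair (s ≫ a) (t ≫ b) n h := by
  rw [tensorPair, tensorHom_comp_tensorHom_assoc, tensorPair]

lemma whiskerRight_tensorPair {S' : A} (s : S' ⟶ S) (a : S ⟶ K.X i) (b : T ⟶ L.X j)
    (n : ℤ) (h : i + j = n) : s ▷ T ≫ tensorPair a b n h = tensorPair (s ≫ a) b n h := by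
  rw [← tensorHom_id, comp_tensorPair, id_comp]

lemma whiskerLeft_tensorPair {T' : A} (t : T' ⟶ T) (a : S ⟶ K.X i) (b : T ⟶ L.X j)
    (n : ℤ) (h : i + j = n) : S ◁ t ≫ tensorPair a b n h = tensorPair a (t ≫ b) n h := by
  rw [← id_tensorHom, comp_tensorPair, id_comp]

lemma tensorPair_add_left (a a' : S ⟶ K.X i) (b : T ⟶ L.X j) (n : ℤ) (h : i + j = n) :
    tensorPair (a + a') b n h = tensorPair a b n h + tensorPair a' b n h := by
  simp only [tensorPair, MonoidalPreadditive.add_tensor, Preadditive.add_comp]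

lemma tensorPair_add_right (a : S ⟶ K.X i) (b b' : T ⟶ L.X j) (n : ℤ) (h : i + j = n) :
    tensorPair a (b + b') n h = tensorPair a b n h + tensorPair a b' n h := by
  simp only [tensorPair, MonoidalPreadditive.tensor_add, Preadditive.add_comp]

lemma tensorPair_zero_left (b : T ⟶ L.X j) (n : ℤ) (h : i + j = n) :
    tensorPair (0 : S ⟶ K.X i) b n h = 0 := by
  simp only [tensorPair, MonoidalPreadditive.zero_tensor, zero_comp]

lemma tensorPair_zero_right (a : S ⟶ K.X i) (n : ℤ) (h : i + j = n) :
    tensorPair a (0 : T ⟶ L.X j) n h = 0 := by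
  simp only [tensorPair, MonoidalPreadditive.tensor_zero, zero_comp]

lemma tensorPair_d (a : S ⟶ K.X i) (b : T ⟶ L.X j) (i' j' n n' : ℤ) (h : i + j = n)
    (hi : i' + 1 = i) (hj : j' + 1 = j) (hn : n' + 1 = n) :
    tensorPair a b n h ≫ (K ⊗ L).d n n' =
      tensorPair (a ≫ K.d i i') b n' (by omega) +
        i.negOnePow • tensorPair a (b ≫ L.d j j') n' (by omega) := by
  have := KoszulBraiding.ι_d K L i j i' j' n n' h hi hj hn
  rw [tensorPair, assoc]
  refine (congrArg ((a ⊗ₘ b) ≫ ·) this).trans ?_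
  rw [Preadditive.comp_add, KoszulBraiding.comp_units_smul', ← tensorHom_id, ← id_tensorHom,
    tensorHom_comp_tensorHom_assoc, tensorHom_comp_tensorHom_assoc, comp_id, comp_id,
    tensorPair, tensorPair]

lemma tensorPair_braiding (a : S ⟶ K.X i) (b : T ⟶ L.X j) (n : ℤ) (h : i + j = n) :
    tensorPair a b n h ≫ (β_ K L).hom.f n =
      (i * j).negOnePow • ((β_ S T).hom ≫ tensorPair b a n (by omega)) := by
  have := KoszulBraiding.ι_braidX K L i j n h
  rw [tensorPair, assoc]
  refine (congrArg ((a ⊗ₘ b) ≫ ·) this).trans ?_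
  rw [KoszulBraiding.comp_units_smul', BraidedCategory.braiding_naturality_assoc, tensorPair]

lemma tensorPair_associator (a : R ⟶ K.X i) (b : S ⟶ L.X j) (c : T ⟶ M.X k)
    (m m' n : ℤ) (h : i + j = m) (h' : m + k = n) (h'' : j + k = m') :
    tensorPair (tensorPair a b m h) c n h' ≫ (α_ K L M).hom.f n =
      (α_ R S T).hom ≫ tensorPair a (tensorPair b c m' h'') n (by omega) := by
  -- Both bracketings factor through the inclusion of a triple summand, on which the associator is
  -- given by `e`.
  subst h h''
  have e := GradedObject.Monoidal.ιTensorObj₃'_associator_hom K.X L.X M.X i j k n h'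
  have e1 : tensorPair (tensorPair a b (i + j) rfl) c n h' = ((a ⊗ₘ b) ⊗ₘ c) ≫
      GradedObject.Monoidal.ιTensorObj₃' K.X L.X M.X i j k n h' := by
    rw [GradedObject.Monoidal.ιTensorObj₃'_eq K.X L.X M.X i j k n h' _ rfl, ← tensorHom_id,
      tensorHom_comp_tensorHom_assoc, comp_id]
    rfl
  have e2 : tensorPair a (tensorPair b c (j + k) rfl) n (by omega) = (a ⊗ₘ (b ⊗ₘ c)) ≫
      GradedObject.Monoidal.ιTensorObj₃ K.X L.X M.X i j k n h' := by
    rw [GradedObject.Monoidal.ιTensorObj₃_eq K.X L.X M.X i j k n h' _ rfl, ← id_tensorHom,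
      tensorHom_comp_tensorHom_assoc, comp_id]
    rfl
  rw [e1, e2]
  exact (assoc _ _ _).trans ((congrArg (fun x => ((a ⊗ₘ b) ⊗ₘ c) ≫ x) e).trans
    (associator_naturality_assoc a b c _))

lemma tensorPair_associator_inv (a : R ⟶ K.X i) (b : S ⟶ L.X j) (c : T ⟶ M.X k)
    (m m' n : ℤ) (h : j + k = m) (h' : i + m = n) (h'' : i + j = m') :
    tensorPair a (tensorPair b c m h) n h' ≫ (α_ K L M).inv.f n =
      (α_ R S T).inv ≫ tensorPair (tensorPair a b m' h'') c n (by omega) := by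
  have hf : (α_ K L M).hom.f n ≫ (α_ K L M).inv.f n = 𝟙 _ := by
    rw [← HomologicalComplex.comp_f, Iso.hom_inv_id, HomologicalComplex.id_f]
  rw [Iso.eq_inv_comp, ← assoc, ← tensorPair_associator a b c m' m n h'' (by omega) h, assoc, hf,
    comp_id]

/-- This is the adjacent transposition from which `moveLast` is built. The Koszul sign is trivial as
soon as one of the two exchanged factors has degree `0`, which is always so below. -/
lemma tensorPair_swap (a : R ⟶ K.X i) (b : S ⟶ L.X j) (c : T ⟶ M.X k)
    (m m' n : ℤ) (h : i + j = m) (h' : m + k = n) (h'' : i + k = m') :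
    tensorPair (tensorPair a b m h) c n h' ≫
        ((α_ K L M).hom ≫ K ◁ (β_ L M).hom ≫ (α_ K M L).inv).f n =
      (j * k).negOnePow • (((α_ R S T).hom ≫ R ◁ (β_ S T).hom ≫ (α_ R T S).inv) ≫
        tensorPair (tensorPair a c m' h'') b n (by omega)) := by
  have hs (r : ℤˣ) (x : S ⊗ T ⟶ (M ⊗ L).X (j + k)) :
      tensorPair a (r • x) n (by omega) = r • tensorPair a x n (by omega) := by
    obtain rfl | rfl := Int.units_eq_one_or r
    · simp
    · rw [eq_comm, Units.smul_def, Units.smul_def]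
      simp only [Units.val_neg, Units.val_one, neg_smul, one_smul]
      rw [neg_eq_iff_add_eq_zero, ← tensorPair_add_right, add_neg_cancel, tensorPair_zero_right]
  rw [HomologicalComplex.comp_f, HomologicalComplex.comp_f,
    reassoc_of% tensorPair_associator a b c m (j + k) n h h' rfl,
    reassoc_of% tensorPair_whiskerLeft a (tensorPair b c (j + k) rfl) n (by omega) (β_ L M).hom,
    tensorPair_braiding, hs, ← whiskerLeft_tensorPair, KoszulBraiding.units_smul_comp', assoc,
    tensorPair_associator_inv a c b (j + k) m' n (by omega) (by omega) h'',
    KoszulBraiding.comp_units_smul', assoc, assoc]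

/-- The identification of the unit of `A` with the degree `0` part of the unit complex. -/
def unitZero : 𝟙_ A ⟶ (𝟙_ (ChainComplex A ℤ)).X 0 :=
  (HomologicalComplex.singleObjXSelf (ComplexShape.down ℤ) 0 (𝟙_ A)).inv

lemma unitZero_d (n : ℤ) : unitZero ≫ (𝟙_ (ChainComplex A ℤ)).d 0 n = 0 := by
  change _ ≫ ((HomologicalComplex.single A (ComplexShape.down ℤ) 0).obj (𝟙_ A)).d 0 n = 0
  rw [HomologicalComplex.single_obj_d, comp_zero]

lemma leftUnitor_inv_f (i : ℤ) :
    (λ_ K).inv.f i = (λ_ (K.X i)).inv ≫ tensorPair unitZero (𝟙 (K.X i)) i (zero_add i) := by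
  refine (HomologicalComplex.leftUnitor'_inv K i).trans ?_
  rw [tensorPair, tensorHom_id]
  rfl

lemma rightUnitor_inv_f (i : ℤ) :
    (ρ_ K).inv.f i = (ρ_ (K.X i)).inv ≫ tensorPair (𝟙 (K.X i)) unitZero i (add_zero i) := by
  refine (HomologicalComplex.rightUnitor'_inv K i).trans ?_
  rw [tensorPair, id_tensorHom]
  rfl

lemma comp_leftUnitor_inv_f (a : S ⟶ K.X i) :
    a ≫ (λ_ K).inv.f i = (λ_ S).inv ≫ tensorPair unitZero a i (zero_add i) := by
  rw [leftUnitor_inv_f, leftUnitor_inv_naturality_assoc, whiskerLeft_tensorPair, comp_id]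

lemma comp_rightUnitor_inv_f (a : S ⟶ K.X i) :
    a ≫ (ρ_ K).inv.f i = (ρ_ S).inv ≫ tensorPair a unitZero i (add_zero i) := by
  rw [rightUnitor_inv_f, rightUnitor_inv_naturality_assoc, whiskerRight_tensorPair, comp_id]

/-- The inverse unitor lands in a single summand and is computed directly; the unitor is then
determined on that summand by cancellation. -/
lemma tensorPair_leftUnitor (a : S ⟶ K.X i) :
    tensorPair unitZero a i (zero_add i) ≫ (λ_ K).hom.f i = (λ_ S).hom ≫ a := by
  have hf : (λ_ K).inv.f i ≫ (λ_ K).hom.f i = 𝟙 _ := by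
    rw [← HomologicalComplex.comp_f, Iso.inv_hom_id, HomologicalComplex.id_f]
  rw [← cancel_epi (λ_ S).inv, ← reassoc_of% comp_leftUnitor_inv_f a, hf, comp_id,
    Iso.inv_hom_id_assoc]

lemma tensorPair_rightUnitor (a : S ⟶ K.X i) :
    tensorPair a unitZero i (add_zero i) ≫ (ρ_ K).hom.f i = (ρ_ S).hom ≫ a := by
  have hf : (ρ_ K).inv.f i ≫ (ρ_ K).hom.f i = 𝟙 _ := by
    rw [← HomologicalComplex.comp_f, Iso.inv_hom_id, HomologicalComplex.id_f]
  rw [← cancel_epi (ρ_ S).inv, ← reassoc_of% comp_rightUnitor_inv_f a, hf, comp_id,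
    Iso.inv_hom_id_assoc]

end TensorPair

/-! ### Adding one letter to a word -/

section Append

variable {V K L P : ChainComplex A ℤ} {R S T : A}

lemma biprod_desc_d_id (V : ChainComplex A ℤ) :
    biprod.desc (V.d 1 0) (𝟙 (V.X 0)) = biprod.fst ≫ V.d 1 0 + biprod.snd := by
  ext <;> simp

/-- The extension of a map `S ⟶ K₀` by zero on the words ending with `V₁`. -/
def appendZero (V : ChainComplex A ℤ) (a₀ : S ⟶ K.X 0) :
    S ⊗ (V.X 1 ⊞ V.X 0) ⟶ (K ⊗ V).X 0 :=
  tensorPair a₀ biprod.snd 0 (add_zero 0)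

/-- The extension of a map `S ⟶ K₀` by `d` on an additional letter `V₁`. -/
def appendTotal (V : ChainComplex A ℤ) (t : S ⟶ K.X 0) :
    S ⊗ (V.X 1 ⊞ V.X 0) ⟶ (K ⊗ V).X 0 :=
  tensorPair t (biprod.desc (V.d 1 0) (𝟙 (V.X 0))) 0 (add_zero 0)

/-- The recursive step in the definition of `partialOne`. -/
def appendOne (V : ChainComplex A ℤ) (a₁ : S ⟶ K.X 1) (a₀ : S ⟶ K.X 0) :
    S ⊗ (V.X 1 ⊞ V.X 0) ⟶ (K ⊗ V).X 1 :=
  tensorPair a₁ (biprod.desc (V.d 1 0) (𝟙 (V.X 0))) 1 (add_zero 1) +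
    tensorPair a₀ biprod.fst 1 (zero_add 1)

lemma appendZero_d (hV : IsZero (V.X (-1))) {a₀ : S ⟶ K.X 0} (h : a₀ ≫ K.d 0 (-1) = 0) :
    appendZero V a₀ ≫ (K ⊗ V).d 0 (-1) = 0 := by
  rw [appendZero, tensorPair_d a₀ biprod.snd (-1) (-1) 0 (-1) (by omega) (by omega) (by omega)
      (by omega), h, hV.eq_of_tgt (V.d 0 (-1)) 0, comp_zero, tensorPair_zero_left,
      tensorPair_zero_right, smul_zero, add_zero]

/-- In the Leibniz rule the first summand only keeps `(a₁ d) ⊗ (d + 1)`, because `V₋₁ = 0`, and the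
second only keeps `a₀ ⊗ d`, because `a₀` lands in cycles. Adding `appendZero V a₀` completes `a₀ ⊗
d` to `a₀ ⊗ (d + 1)`. -/
lemma appendOne_d (hV : IsZero (V.X (-1))) (a₁ : S ⟶ K.X 1) {a₀ : S ⟶ K.X 0}
    (h : a₀ ≫ K.d 0 (-1) = 0) :
    appendOne V a₁ a₀ ≫ (K ⊗ V).d 1 0 + appendZero V a₀ =
      appendTotal V (a₁ ≫ K.d 1 0 + a₀) := by
  rw [appendOne, appendZero, appendTotal, Preadditive.add_comp,
    tensorPair_d a₁ _ 0 (-1) 1 0 (by omega) (by omega) (by omega) (by omega),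
    tensorPair_d a₀ _ (-1) 0 1 0 (by omega) (by omega) (by omega) (by omega),
    hV.eq_of_tgt (V.d 0 (-1)) 0, comp_zero, tensorPair_zero_right, smul_zero, add_zero, h,
    tensorPair_zero_left]
  simp only [zero_add, Int.negOnePow_zero, one_smul]
  rw [add_assoc, ← tensorPair_add_right, ← biprod_desc_d_id, ← tensorPair_add_left]

lemma appendZero_associator {g : P ⟶ K ⊗ L} {g' : R ⟶ S ⊗ T} {x₀ : R ⟶ P.X 0} {a₀ : S ⟶ K.X 0}
    {b₀ : T ⟶ L.X 0} (h₀ : x₀ ≫ g.f 0 = g' ≫ tensorPair a₀ b₀ 0 (add_zero 0)) :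
    appendZero V x₀ ≫ (g ▷ V ≫ (α_ K L V).hom).f 0 =
      (g' ▷ _ ≫ (α_ S T _).hom) ≫ tensorPair a₀ (appendZero V b₀) 0 (add_zero 0) := by
  rw [HomologicalComplex.comp_f, appendZero, appendZero, reassoc_of% tensorPair_whiskerRight, h₀,
    assoc, ← tensorPair_associator _ _ _ 0 0 0 (by omega) (by omega),
    reassoc_of% whiskerRight_tensorPair]

/-- Inductive step for concatenation: `P`, `K`, `L` stand for the powers carrying `uv`, `u`, `v`,
and a letter is added after `v`. If the leftmost `V₁` is in `u`, then `d` also acts on the new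
letter, so the total `t` of `v` is extended as a total; otherwise the new letter is absorbed in the
recursion for `v`. -/
lemma appendOne_associator {g : P ⟶ K ⊗ L} {g' : R ⟶ S ⊗ T} {x₀ : R ⟶ P.X 0} {x₁ : R ⟶ P.X 1}
    {a₀ : S ⟶ K.X 0} {a₁ : S ⟶ K.X 1} {b₀ t : T ⟶ L.X 0} {b₁ : T ⟶ L.X 1}
    (h₀ : x₀ ≫ g.f 0 = g' ≫ tensorPair a₀ b₀ 0 (add_zero 0))
    (h₁ : x₁ ≫ g.f 1 = g' ≫ (tensorPair a₁ t 1 (add_zero 1) + tensorPair a₀ b₁ 1 (zero_add 1))) :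
    appendOne V x₁ x₀ ≫ (g ▷ V ≫ (α_ K L V).hom).f 1 =
      (g' ▷ _ ≫ (α_ S T _).hom) ≫ (tensorPair a₁ (appendTotal V t) 1 (add_zero 1) +
        tensorPair a₀ (appendOne V b₁ b₀) 1 (zero_add 1)) := by
  rw [HomologicalComplex.comp_f, appendOne, appendOne, appendTotal, Preadditive.add_comp,
    reassoc_of% tensorPair_whiskerRight x₁, reassoc_of% tensorPair_whiskerRight x₀, h₀, h₁,
    tensorPair_add_right, ← whiskerRight_tensorPair, ← whiskerRight_tensorPair, tensorPair_add_left]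
  simp only [Preadditive.comp_add, Preadditive.add_comp, assoc, add_assoc,
    tensorPair_associator a₁ t _ 1 0 1 (add_zero 1) (add_zero 1) (add_zero 0),
    tensorPair_associator a₀ b₁ _ 1 1 1 (zero_add 1) (add_zero 1) (add_zero 1),
    tensorPair_associator a₀ b₀ _ 0 1 1 (add_zero 0) (zero_add 1) (zero_add 1)]

variable {g : V ⊗ K ⟶ P} {g' : (V.X 1 ⊞ V.X 0) ⊗ S ⟶ R} {x₀ : R ⟶ P.X 0} {x₁ : R ⟶ P.X 1}
  {b₀ t : S ⟶ K.X 0} {b₁ : S ⟶ K.X 1}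

lemma cons_appendZero (h₀ : g' ≫ x₀ = tensorPair biprod.snd b₀ 0 (add_zero 0) ≫ g.f 0) :
    ((α_ _ _ _).inv ≫ g' ▷ _) ≫ appendZero V x₀ =
      tensorPair biprod.snd (appendZero V b₀) 0 (add_zero 0) ≫
        ((α_ V K V).inv ≫ g ▷ V).f 0 := by
  rw [HomologicalComplex.comp_f, appendZero, appendZero,
    reassoc_of% tensorPair_associator_inv biprod.snd b₀ biprod.snd 0 0 0 (by omega)
      (by omega) (by omega), tensorPair_whiskerRight, ← h₀, assoc, whiskerRight_tensorPair]

/-- Inductive step for splitting off the first letter. Tensor powers grow on the right, so the new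
letter is added at the other end and only has to be carried past the associator. -/
lemma cons_appendOne (h₀ : g' ≫ x₀ = tensorPair biprod.snd b₀ 0 (add_zero 0) ≫ g.f 0)
    (h₁ : g' ≫ x₁ = (tensorPair biprod.fst t 1 (add_zero 1) +
      tensorPair biprod.snd b₁ 1 (zero_add 1)) ≫ g.f 1) :
    ((α_ _ _ _).inv ≫ g' ▷ _) ≫ appendOne V x₁ x₀ =
      (tensorPair biprod.fst (appendTotal V t) 1 (add_zero 1) +
        tensorPair biprod.snd (appendOne V b₁ b₀) 1 (zero_add 1)) ≫
          ((α_ V K V).inv ≫ g ▷ V).f 1 := by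
  rw [HomologicalComplex.comp_f, appendOne, appendOne, appendTotal, tensorPair_add_right,
    Preadditive.add_comp, Preadditive.add_comp,
    reassoc_of% tensorPair_associator_inv biprod.fst t _ 0 1 1 (by omega) (by omega) (by omega),
    reassoc_of% tensorPair_associator_inv biprod.snd b₁ _ 1 1 1 (by omega) (by omega) (by omega),
    reassoc_of% tensorPair_associator_inv biprod.snd b₀ _ 1 0 1 (by omega) (by omega) (by omega),
    tensorPair_whiskerRight, tensorPair_whiskerRight, tensorPair_whiskerRight, assoc,
    Preadditive.comp_add, whiskerRight_tensorPair, whiskerRight_tensorPair, h₀, h₁,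
    Preadditive.add_comp, tensorPair_add_left, Preadditive.comp_add, Preadditive.comp_add,
    add_assoc]

/-- Given maps `a₀ : S ⟶ K₀` and `a₁ : S ⟶ K₁`, this says that an endomorphism `p` of `K` restricts
to an endomorphism `p'` of `S`, in degree `1` modulo boundaries. -/
structure RestrictsModBoundaries (a₀ : S ⟶ K.X 0) (a₁ : S ⟶ K.X 1) (p : K ⟶ K) (p' : S ⟶ S) :
    Prop where
  zero : a₀ ≫ p.f 0 = p' ≫ a₀
  one : ∃ h : S ⟶ K.X 2, a₁ ≫ p.f 1 = p' ≫ a₁ + h ≫ K.d 2 1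

/-! ### Commutation with `∂` modulo boundaries -/

namespace RestrictsModBoundaries

lemma id (a₀ : S ⟶ K.X 0) (a₁ : S ⟶ K.X 1) : RestrictsModBoundaries a₀ a₁ (𝟙 K) (𝟙 S) where
  zero := by rw [HomologicalComplex.id_f, comp_id, id_comp]
  one := ⟨0, by rw [HomologicalComplex.id_f, comp_id, id_comp, zero_comp, add_zero]⟩

variable {a₀ : S ⟶ K.X 0} {a₁ : S ⟶ K.X 1}

lemma comp {p q : K ⟶ K} {p' q' : S ⟶ S} (hp : RestrictsModBoundaries a₀ a₁ p p')
    (hq : RestrictsModBoundaries a₀ a₁ q q') :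
    RestrictsModBoundaries a₀ a₁ (p ≫ q) (p' ≫ q') where
  zero := by rw [HomologicalComplex.comp_f, reassoc_of% hp.zero, hq.zero, assoc]
  one := by
    obtain ⟨h, e⟩ := hp.one
    obtain ⟨h', e'⟩ := hq.one
    -- The error of `q` is precomposed with `p'`; the error of `p` is pushed through `q`, which
    -- commutes with `d`.
    refine ⟨p' ≫ h' + h ≫ q.f 2, ?_⟩
    rw [HomologicalComplex.comp_f, reassoc_of% e, Preadditive.add_comp, assoc, e',
      Preadditive.comp_add, Preadditive.add_comp, assoc, assoc, assoc, assoc, q.comm, add_assoc]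

lemma whiskerRight (hV : IsZero (V.X (-1))) {p : K ⟶ K} {p' : S ⟶ S}
    (hp : RestrictsModBoundaries a₀ a₁ p p') :
    RestrictsModBoundaries (appendZero V a₀) (appendOne V a₁ a₀) (p ▷ V)
      (p' ▷ (V.X 1 ⊞ V.X 0)) where
  zero := by
    rw [appendZero, tensorPair_whiskerRight, whiskerRight_tensorPair, hp.zero]
  one := by
    obtain ⟨h, e⟩ := hp.one
    -- Only the summand `a₁ ⊗ (d + 1)` carries an error, namely `(h d) ⊗ (d + 1)`; it is the
    -- boundary of `h ⊗ (d + 1)` because `V₋₁ = 0`.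
    refine ⟨tensorPair h (biprod.desc (V.d 1 0) (𝟙 (V.X 0))) 2 (add_zero 2), ?_⟩
    rw [appendOne, Preadditive.add_comp, Preadditive.comp_add, tensorPair_whiskerRight,
      tensorPair_whiskerRight, whiskerRight_tensorPair, whiskerRight_tensorPair, hp.zero, e,
      tensorPair_add_left, tensorPair_d h _ 1 (-1) 2 1 (by omega) (by omega) (by omega) (by omega),
      hV.eq_of_tgt (V.d 0 (-1)) 0, comp_zero, tensorPair_zero_right, smul_zero, add_zero,
      add_right_comm]

/-- The heart of equivariance. The terms in `a₁` have `d + 1` on both letters and are symmetric, and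
the terms in `a₀` with one letter `V₁` and one letter `V₀` are exchanged. Only `a₀` followed by two
letters `V₁` leaves a discrepancy. -/
lemma swap (V : ChainComplex A ℤ) (h : a₀ ≫ K.d 0 (-1) = 0) :
    RestrictsModBoundaries (appendZero V (appendZero V a₀))
      (appendOne V (appendOne V a₁ a₀) (appendZero V a₀))
      ((α_ K V V).hom ≫ K ◁ (β_ V V).hom ≫ (α_ K V V).inv)
      ((α_ _ _ _).hom ≫ S ◁ (β_ _ _).hom ≫ (α_ _ _ _).inv) where
  zero := by
    rw [appendZero, appendZero, tensorPair_swap _ _ _ 0 0 0 (by omega) (by omega) (by omega),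
      mul_zero, Int.negOnePow_zero, one_smul]
  one := by
    -- As `a₀` lands in cycles, the boundary of `a₀ ⊗ x ⊗ y` is `a₀ ⊗ dx ⊗ y - a₀ ⊗ x ⊗ dy`, which
    -- is the discrepancy; the minus sign comes from the degree `1` of `a₀ ⊗ x`.
    refine ⟨((α_ _ _ _).hom ≫ S ◁ (β_ _ _).hom ≫ (α_ _ _ _).inv) ≫
      tensorPair (tensorPair a₀ biprod.fst 1 (zero_add 1)) biprod.fst 2 (by omega), ?_⟩
    -- The exchange of letters is a common left factor of all terms, kept opaque until it is
    -- cancelled.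
    generalize hs : ((α_ S (V.X 1 ⊞ V.X 0) (V.X 1 ⊞ V.X 0)).hom ≫
      _ ◁ (β_ _ _).hom ≫ (α_ _ _ _).inv) = s
    rw [appendOne, appendOne, appendZero, tensorPair_add_left, Preadditive.add_comp,
      Preadditive.add_comp,
      tensorPair_swap _ _ _ 1 1 1 (by omega) (by omega) (by omega),
      tensorPair_swap _ _ _ 1 0 1 (by omega) (by omega) (by omega),
      tensorPair_swap _ _ _ 0 1 1 (by omega) (by omega) (by omega), hs]
    simp only [mul_zero, zero_mul, Int.negOnePow_zero, one_smul]
    rw [assoc, ← Preadditive.comp_add, ← Preadditive.comp_add, ← Preadditive.comp_add]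
    congr 1
    rw [tensorPair_d (tensorPair a₀ biprod.fst 1 (zero_add 1)) _ 0 0 2 1 (by omega)
        (by omega) (by omega) (by omega),
      tensorPair_d a₀ _ (-1) 0 1 0 (by omega) (by omega) (by omega) (by omega),
      h, tensorPair_zero_left, biprod_desc_d_id, Int.negOnePow_one]
    simp only [zero_add, Int.negOnePow_zero, Units.neg_smul, one_smul, tensorPair_add_right,
      tensorPair_add_left]
    abel

end RestrictsModBoundaries

end Append

/-! ### The components of `∂` under concatenation and permutation -/

section Partial

variable (V : ChainComplex A ℤ)

lemma partialZero_d (n : ℕ) (h : IsZero (V.X (-1))) :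
    partialZero V n ≫ (tensorPow V n).d 0 (-1) = 0 := by
  induction n with
  | zero => exact unitZero_d _
  | succ n ih => exact appendZero_d h ih

/-- The map `(V₁ ⊕ V₀)^{⊗ n} ⟶ (V^{⊗ n})₀` which applies `d` to all copies of `V₁`. -/
def partialTotal (n : ℕ) : tensorPow (V.X 1 ⊞ V.X 0) n ⟶ (tensorPow V n).X 0 :=
  partialOne V n ≫ (tensorPow V n).d 1 0 + partialZero V n

lemma partialTotal_zero : partialTotal V 0 = unitZero := by
  rw [partialTotal, partialOne, zero_comp, zero_add]
  rfl

/-- This makes the total multiplicative: it is the tensor power of `d + 1 : V₁ ⊕ V₀ ⟶ V₀`. -/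
lemma partialTotal_succ (n : ℕ) (h : IsZero (V.X (-1))) :
    partialTotal V (n + 1) = appendTotal V (partialTotal V n) :=
  appendOne_d h (partialOne V n) (partialZero_d V n h)

lemma partialOne_one :
    partialOne V (0 + 1) = tensorPair unitZero biprod.fst 1 (zero_add 1) := by
  change appendOne V 0 unitZero = _
  rw [appendOne, tensorPair_zero_left, zero_add]

lemma partialZero_tensorPowAdd (m n : ℕ) :
    partialZero V (m + n) ≫ (tensorPowAdd V m n).hom.f 0 =
      (tensorPowAdd (V.X 1 ⊞ V.X 0) m n).hom ≫
        tensorPair (partialZero V m) (partialZero V n) 0 (add_zero 0) := by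
  induction n with
  | zero => exact comp_rightUnitor_inv_f _
  | succ n ih => exact appendZero_associator ih

lemma partialOne_tensorPowAdd (m n : ℕ) (h : IsZero (V.X (-1))) :
    partialOne V (m + n) ≫ (tensorPowAdd V m n).hom.f 1 =
      (tensorPowAdd (V.X 1 ⊞ V.X 0) m n).hom ≫
        (tensorPair (partialOne V m) (partialTotal V n) 1 (add_zero 1) +
          tensorPair (partialZero V m) (partialOne V n) 1 (zero_add 1)) := by
  induction n with
  | zero =>
    -- The empty word has no letter `V₁`, so `partialOne V 0` vanishes, while its total is the unit.
    have e : tensorPair (partialZero V m) (partialOne V 0) 1 (zero_add 1) = 0 :=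
      tensorPair_zero_right _ _ _
    rw [e, add_zero (tensorPair (partialOne V m) (partialTotal V 0) 1 (add_zero 1)),
      partialTotal_zero]
    exact comp_rightUnitor_inv_f _
  | succ n ih =>
    rw [partialTotal_succ V n h]
    exact appendOne_associator (partialZero_tensorPowAdd V m n) ih

lemma tensorPowCons_partialZero (n : ℕ) :
    (tensorPowCons (V.X 1 ⊞ V.X 0) n).hom ≫ partialZero V (n + 1) =
      tensorPair biprod.snd (partialZero V n) 0 (add_zero 0) ≫ (tensorPowCons V n).hom.f 0 := by
  induction n with
  | zero =>
    change ((ρ_ _).hom ≫ (λ_ _).inv) ≫ tensorPair unitZero biprod.snd 0 (add_zero 0) =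
      tensorPair biprod.snd unitZero 0 (add_zero 0) ≫ ((ρ_ V).hom ≫ (λ_ V).inv).f 0
    rw [HomologicalComplex.comp_f, reassoc_of% tensorPair_rightUnitor, comp_leftUnitor_inv_f, assoc]
  | succ n ih => exact cons_appendZero ih

/-- A first letter `V₁` is the leftmost one, so `d` acts on all the others; after a first letter
`V₀`, the leftmost `V₁` is sought in the rest. -/
lemma tensorPowCons_partialOne (n : ℕ) (h : IsZero (V.X (-1))) :
    (tensorPowCons (V.X 1 ⊞ V.X 0) n).hom ≫ partialOne V (n + 1) =
      (tensorPair biprod.fst (partialTotal V n) 1 (add_zero 1) +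
        tensorPair biprod.snd (partialOne V n) 1 (zero_add 1)) ≫ (tensorPowCons V n).hom.f 1 := by
  induction n with
  | zero =>
    rw [partialTotal_zero, partialOne_one, partialOne, tensorPair_zero_right, add_zero]
    change ((ρ_ _).hom ≫ (λ_ _).inv) ≫ tensorPair unitZero biprod.fst 1 (zero_add 1) =
      tensorPair biprod.fst unitZero 1 (add_zero 1) ≫ ((ρ_ V).hom ≫ (λ_ V).inv).f 1
    rw [HomologicalComplex.comp_f, reassoc_of% tensorPair_rightUnitor, comp_leftUnitor_inv_f, assoc]
  | succ n ih =>
    rw [partialTotal_succ V n h]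
    exact cons_appendOne (tensorPowCons_partialZero V n) ih

lemma moveLast_last {C : Type*} [Category C] [MonoidalCategory C] [BraidedCategory C] (X : C)
    (n : ℕ) : moveLast X (n + 1) (Fin.last (n + 1)) = 𝟙 _ := by
  unfold moveLast
  exact Fin.lastCases_last

lemma moveLast_castSucc {C : Type*} [Category C] [MonoidalCategory C] [BraidedCategory C] (X : C)
    (n : ℕ) (q : Fin (n + 1)) : moveLast X (n + 1) q.castSucc =
      (((α_ (tensorPow X n) X X).hom ≫ tensorPow X n ◁ (β_ X X).hom ≫
        (α_ (tensorPow X n) X X).inv) ≫ moveLast X n q ▷ X :) := by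
  rw [assoc, assoc]
  conv_lhs => unfold moveLast
  exact Fin.lastCases_castSucc q

lemma moveLast_restrictsModBoundaries (hV : IsZero (V.X (-1))) (n : ℕ) (q : Fin (n + 1)) :
    RestrictsModBoundaries (K := tensorPow V (n + 1)) (partialZero V (n + 1))
      (partialOne V (n + 1)) (moveLast V n q) (moveLast (V.X 1 ⊞ V.X 0) n q) := by
  induction n with
  | zero => exact .id _ _
  | succ n ih =>
    induction q using Fin.lastCases with
    | last =>
      rw [moveLast_last, moveLast_last]
      exact .id _ _
    | cast q =>
      rw [moveLast_castSucc, moveLast_castSucc]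
      exact (RestrictsModBoundaries.swap V (partialZero_d V n hV)).comp ((ih q).whiskerRight hV)

lemma tensorPowPerm_restrictsModBoundaries (hV : IsZero (V.X (-1))) {n : ℕ}
    (σ : Equiv.Perm (Fin n)) :
    RestrictsModBoundaries (partialZero V n) (partialOne V n) (tensorPowPerm V σ)
      (tensorPowPerm (V.X 1 ⊞ V.X 0) σ) := by
  induction n with
  | zero => exact .id _ _
  | succ n ih =>
    exact ((ih (permInit σ)).whiskerRight hV).comp (moveLast_restrictsModBoundaries V hV n _)

end Partial

/-! ### Restricting objects of chain maps along maps into degrees `1` and `0` -/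

section Restrict

open MonoidalClosed (pre)
open scoped MonoidalClosed
open HomologicalComplex (ιTensorObj)

lemma pre_app_comp {X Y Z : A} (f : X ⟶ Y) (g : Y ⟶ Z) (W : A) :
    (pre (f ≫ g)).app W = (pre g).app W ≫ (pre f).app W := by
  rw [MonoidalClosed.pre_map, NatTrans.comp_app]

lemma curry'_pre_app {X Y Z : A} (f : X ⟶ Y) (g : Y ⟶ Z) :
    MonoidalClosed.curry' g ≫ (pre f).app Z = MonoidalClosed.curry' (f ≫ g) := by
  apply MonoidalClosed.uncurry_injective
  rw [MonoidalClosed.uncurry_pre_app, MonoidalClosed.curry', MonoidalClosed.curry',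
    MonoidalClosed.uncurry_curry, MonoidalClosed.uncurry_curry,
    MonoidalCategory.rightUnitor_naturality_assoc]

lemma curry'_add {X Y : A} (f g : X ⟶ Y) :
    MonoidalClosed.curry' (f + g) = MonoidalClosed.curry' f + MonoidalClosed.curry' g := by
  rw [← comp_id (f + g), ← curry'_pre_app, pre_app_add, Preadditive.comp_add, curry'_pre_app,
    curry'_pre_app, comp_id, comp_id]

variable {V X Y N L P M : ChainComplex A ℤ}

lemma eHomWhiskerRight_ev (f : X ⟶ Y) (Z : ChainComplex A ℤ) (n : ℤ) :
    (eHomWhiskerRight A f Z : chainHom Y Z ⟶ chainHom X Z) ≫ chainHomEv X Z n =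
      chainHomEv Y Z n ≫ (pre (f.f n)).app (Z.X n) := by
  change ((λ_ _).inv ≫ chainHomOfHom f ▷ _ ≫ chainHomComp X Y Z) ≫ _ = _
  rw [assoc, assoc, chainHomComp_ev, ← tensorHom_id, tensorHom_comp_tensorHom_assoc,
    chainHomOfHom_ev, id_comp, tensorHom_def', assoc, MonoidalClosed.curry'_whiskerRight_comp,
    leftUnitor_naturality_assoc, Iso.inv_hom_id_assoc]

lemma eHomWhiskerLeft_ev (X : ChainComplex A ℤ) {Y Z : ChainComplex A ℤ} (f : Y ⟶ Z) (n : ℤ) :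
    (eHomWhiskerLeft A X f : chainHom X Y ⟶ chainHom X Z) ≫ chainHomEv X Z n =
      chainHomEv X Y n ≫ (ihom (X.X n)).map (f.f n) := by
  change ((ρ_ _).inv ≫ _ ◁ chainHomOfHom f ≫ chainHomComp X Y Z) ≫ _ = _
  rw [assoc, assoc, chainHomComp_ev, ← id_tensorHom, tensorHom_comp_tensorHom_assoc,
    chainHomOfHom_ev, id_comp, MonoidalCategory.tensorHom_def, assoc, MonoidalClosed.whiskerLeft_curry'_comp,
    rightUnitor_naturality_assoc, Iso.inv_hom_id_assoc]

/-- The map `f ↦ f₁ ∘ a₁ ⊕ f₀ ∘ a₀`. -/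
def chainHomRestrict (V : ChainComplex A ℤ) {S : A} (a₁ : S ⟶ X.X 1) (a₀ : S ⟶ X.X 0) :
    chainHom X V ⟶ (ihom S).obj (V.X 1 ⊞ V.X 0) :=
  chainHomEv X V 1 ≫ (pre a₁).app _ ≫ (ihom S).map biprod.inl +
    chainHomEv X V 0 ≫ (pre a₀).app _ ≫ (ihom S).map biprod.inr

/-- In this form the two components of `∂` enter separately and can be rewritten one degree at a
time. -/
lemma rtimesMap_eq (V : ChainComplex A ℤ) (n : ℕ) :
    rtimesMap V n = chainHomRestrict V (partialOne V n) (partialZero V n) := by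
  rw [rtimesMap, ihomDiag, biprod.lift_desc_assoc, Preadditive.add_comp, assoc, assoc, assoc, assoc,
    ← MonoidalClosed.pre_comm_ihom_map, ← MonoidalClosed.pre_comm_ihom_map,
    ← reassoc_of% pre_app_comp, ← reassoc_of% pre_app_comp, partialMap, biprod.lift_fst,
    biprod.lift_snd, chainHomRestrict]

lemma ihom_map_zero (S : A) (Y Z : A) : (ihom S).map (0 : Y ⟶ Z) = 0 := by
  rw [← add_eq_left (a := (ihom S).map (0 : Y ⟶ Z)), ← ihom_map_add, add_zero]

variable {S : A} (a₁ : S ⟶ X.X 1) (a₀ : S ⟶ X.X 0)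

lemma chainHomRestrict_fst :
    chainHomRestrict V a₁ a₀ ≫ (ihom S).map biprod.fst = chainHomEv X V 1 ≫ (pre a₁).app _ := by
  rw [chainHomRestrict, Preadditive.add_comp, assoc, assoc, assoc, assoc, ← Functor.map_comp,
    ← Functor.map_comp, biprod.inl_fst, biprod.inr_fst, ihom_map_zero, CategoryTheory.Functor.map_id, comp_zero,
    comp_zero, add_zero, comp_id]

lemma chainHomRestrict_snd :
    chainHomRestrict V a₁ a₀ ≫ (ihom S).map biprod.snd = chainHomEv X V 0 ≫ (pre a₀).app _ := by
  rw [chainHomRestrict, Preadditive.add_comp, assoc, assoc, assoc, assoc, ← Functor.map_comp,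
    ← Functor.map_comp, biprod.inl_snd, biprod.inr_snd, ihom_map_zero, CategoryTheory.Functor.map_id, comp_zero,
    comp_zero, zero_add, comp_id]

variable {a₁ a₀}

lemma RestrictsModBoundaries.whiskerRight_chainHomRestrict (hV : IsZero (V.X 2)) {p : X ⟶ X}
    {p' : S ⟶ S} (h : RestrictsModBoundaries a₀ a₁ p p') :
    (eHomWhiskerRight A p V : chainHom X V ⟶ chainHom X V) ≫ chainHomRestrict V a₁ a₀ =
      chainHomRestrict V a₁ a₀ ≫ (pre p').app _ := by
  obtain ⟨b, hb⟩ := h.one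
  -- This is where `V₂ = 0` enters: `f₁ d = d f₂ = 0`, so the error term of `hb` is killed.
  have hd : chainHomEv X V 1 ≫ (pre (X.d 2 1)).app (V.X 1) = 0 := by
    rw [← chainHomEv_comm, hV.eq_of_src (V.d 2 1) 0, ihom_map_zero, comp_zero]
  rw [chainHomRestrict, Preadditive.comp_add, reassoc_of% eHomWhiskerRight_ev,
    reassoc_of% eHomWhiskerRight_ev, ← reassoc_of% pre_app_comp, ← reassoc_of% pre_app_comp,
    h.zero, hb, pre_app_add, Preadditive.add_comp, Preadditive.comp_add, pre_app_comp b, assoc,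
    reassoc_of% hd, zero_comp, add_zero, Preadditive.add_comp, assoc, assoc, assoc, assoc,
    ← MonoidalClosed.pre_comm_ihom_map, ← MonoidalClosed.pre_comm_ihom_map,
    ← reassoc_of% pre_app_comp, ← reassoc_of% pre_app_comp]

lemma chainHomOfHom_restrict (f : X ⟶ V) :
    chainHomOfHom f ≫ chainHomRestrict V a₁ a₀ =
      MonoidalClosed.curry' (a₁ ≫ f.f 1 ≫ biprod.inl + a₀ ≫ f.f 0 ≫ biprod.inr) := by
  rw [chainHomRestrict, Preadditive.comp_add, reassoc_of% chainHomOfHom_ev,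
    reassoc_of% chainHomOfHom_ev, reassoc_of% curry'_pre_app, reassoc_of% curry'_pre_app,
    MonoidalClosed.curry'_ihom_map, MonoidalClosed.curry'_ihom_map, curry'_add, assoc, assoc]

variable {O Q R T W : A} {q : O ⟶ chainHom N L} {q' : O ⟶ (ihom Q).obj R}

/-- The hypothesis is the internal form of `c ∘ q' = qₙ ∘ b`; the conclusion is this relation
followed by `i ∘ gₙ`, for a variable chain map `g`. -/
lemma ihomComp_of_ev_eq {n : ℤ} {b : Q ⟶ N.X n} {c : R ⟶ L.X n}
    (h : q' ≫ (ihom Q).map c = q ≫ chainHomEv N L n ≫ (pre b).app _) (i : V.X n ⟶ W) :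
    (q' ⊗ₘ chainHomEv L V n ≫ (pre c).app _ ≫ (ihom R).map i) ≫ MonoidalClosed.comp Q R W =
      q ▷ _ ≫ chainHomComp N L V ≫ chainHomEv N V n ≫ (pre b).app _ ≫ (ihom Q).map i := by
  rw [reassoc_of% chainHomComp_ev, reassoc_of% ihomComp_pre, ihomComp_map,
    ← tensorHom_comp_whiskerLeft, MonoidalCategory.whiskerLeft_comp, assoc, assoc,
    ← ihomComp_map, reassoc_of% ihomComp_middle, tensorHom_comp_whiskerRight_assoc, h,
    ← tensorHom_id q, tensorHom_comp_tensorHom_assoc, id_comp, tensorHom_comp_whiskerRight_assoc,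
    assoc, ihomComp_map]

lemma chainHomComp_restrict {b₁ : Q ⟶ N.X 1} {b₀ : Q ⟶ N.X 0} {c₁ : R ⟶ L.X 1} {c₀ : R ⟶ L.X 0}
    (h₁ : q' ≫ (ihom Q).map c₁ = q ≫ chainHomEv N L 1 ≫ (pre b₁).app _)
    (h₀ : q' ≫ (ihom Q).map c₀ = q ≫ chainHomEv N L 0 ≫ (pre b₀).app _) :
    (_ ◁ q ≫ (β_ _ _).hom ≫ chainHomComp N L V) ≫ chainHomRestrict V b₁ b₀ =
      (chainHomRestrict V c₁ c₀ ⊗ₘ q') ≫ (β_ _ _).hom ≫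
        MonoidalClosed.comp Q R (V.X 1 ⊞ V.X 0) := by
  rw [BraidedCategory.braiding_naturality_assoc, BraidedCategory.braiding_naturality_right_assoc,
    assoc, chainHomRestrict, chainHomRestrict, MonoidalPreadditive.tensor_add, Preadditive.add_comp,
    ihomComp_of_ev_eq h₁, ihomComp_of_ev_eq h₀, Preadditive.comp_add, Preadditive.comp_add, assoc, assoc,
    Preadditive.comp_add]

/-- Since `q` consists of chain maps, `d c₁ q' = d q₁ b₁ = q₀ d b₁`. -/
lemma ihom_map_total_of_ev_eq {b₁ : Q ⟶ N.X 1} {b₀ : Q ⟶ N.X 0} {c₁ : R ⟶ L.X 1} {c₀ : R ⟶ L.X 0}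
    (h₁ : q' ≫ (ihom Q).map c₁ = q ≫ chainHomEv N L 1 ≫ (pre b₁).app _)
    (h₀ : q' ≫ (ihom Q).map c₀ = q ≫ chainHomEv N L 0 ≫ (pre b₀).app _) :
    q' ≫ (ihom Q).map (c₁ ≫ L.d 1 0 + c₀) =
      q ≫ chainHomEv N L 0 ≫ (pre (b₁ ≫ N.d 1 0 + b₀)).app _ := by
  rw [ihom_map_add, pre_app_add, Preadditive.comp_add, Functor.map_comp, reassoc_of% h₁, h₀,
    MonoidalClosed.pre_comm_ihom_map, reassoc_of% chainHomEv_comm, ← pre_app_comp,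
    Preadditive.comp_add, Preadditive.comp_add]

/-- Intertwining relations can be tensored: on the summand of bidegree `(i, j)` the map `f ⊗ q` is
`fᵢ ⊗ qⱼ`, without sign. -/
lemma ihomTensor_tensorPair {U : A} {φ : U ⟶ (ihom S).obj T} {f : U ⟶ chainHom X Y}
    {i j : ℤ} {a : S ⟶ X.X i} {r : T ⟶ Y.X i} {b : Q ⟶ N.X j} {c : R ⟶ L.X j}
    (hφ : φ ≫ (ihom S).map r = f ≫ chainHomEv X Y i ≫ (pre a).app _)
    (hq : q' ≫ (ihom Q).map c = q ≫ chainHomEv N L j ≫ (pre b).app _) (n : ℤ) (h : i + j = n) :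
    (φ ⊗ₘ q') ≫ ihomTensor S T Q R ≫ (ihom (S ⊗ Q)).map (tensorPair r c n h) =
      (f ⊗ₘ q) ≫ chainHomTensor X Y N L ≫ chainHomEv (X ⊗ N) (Y ⊗ L) n ≫
        (pre (tensorPair a b n h)).app _ := by
  have e : chainHomTensor X Y N L ≫ chainHomEv (X ⊗ N) (Y ⊗ L) n = chainHomTensorX X Y N L n :=
    chainHomLift_ev _ _ _
  have e' := chainHomTensorX_pre X Y N L i j n h
  have e'' : (pre (a ⊗ₘ b)).app _ ≫ (ihom (S ⊗ Q)).map (ιTensorObj Y L i j n h) =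
      (ihom (X.X i ⊗ N.X j)).map (ιTensorObj Y L i j n h) ≫ (pre (a ⊗ₘ b)).app ((Y ⊗ L).X n) :=
    MonoidalClosed.pre_comm_ihom_map _ _
  rw [tensorPair, tensorPair, Functor.map_comp, pre_app_comp, reassoc_of% ihomTensor_map,
    tensorHom_comp_tensorHom_assoc, hφ, hq, reassoc_of% e, reassoc_of% e',
    ← e'', reassoc_of% ihomTensor_pre, tensorHom_comp_tensorHom_assoc,
    tensorHom_comp_tensorHom_assoc, assoc, assoc]

/-- Carries an intertwining relation along the two isomorphisms in the recursion of
`operationsTensor`: concatenation on the source, attaching the first letter on the target. -/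
lemma ihomTensor_whisker {U S' T' : A} {φ : U ⟶ (ihom S).obj T} {f : U ⟶ chainHom X Y} {n : ℤ}
    {g : P ⟶ X ⊗ N} {g' : S' ⟶ S ⊗ Q} {x : S ⊗ Q ⟶ (X ⊗ N).X n} {p : S' ⟶ P.X n}
    (hg : p ≫ g.f n = g' ≫ x)
    {k : Y ⊗ L ⟶ M} {k' : T ⊗ R ⟶ T'} {y : T ⊗ R ⟶ (Y ⊗ L).X n} {m : T' ⟶ M.X n}
    (hk : k' ≫ m = y ≫ k.f n)
    (h : (φ ⊗ₘ q') ≫ ihomTensor S T Q R ≫ (ihom (S ⊗ Q)).map y =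
      (f ⊗ₘ q) ≫ chainHomTensor X Y N L ≫ chainHomEv (X ⊗ N) (Y ⊗ L) n ≫ (pre x).app _) :
    (φ ⊗ₘ q') ≫ (ihomTensor S T Q R ≫ eHomWhiskerRight A g' (T ⊗ R) ≫ eHomWhiskerLeft A S' k') ≫
        (ihom S').map m =
      (f ⊗ₘ q) ≫ (chainHomTensor X Y N L ≫ eHomWhiskerRight A g (Y ⊗ L) ≫ eHomWhiskerLeft A P k) ≫
        chainHomEv P M n ≫ (pre p).app _ := by
  have e₁ := eHomWhiskerRight_ev g (Y ⊗ L) n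
  have e₂ := eHomWhiskerLeft_ev P k n
  rw [MonoidalClosed.enrichedOrdinaryCategorySelf_eHomWhiskerRight,
    MonoidalClosed.enrichedOrdinaryCategorySelf_eHomWhiskerLeft, assoc, assoc, ← Functor.map_comp,
    hk, Functor.map_comp, reassoc_of% MonoidalClosed.pre_comm_ihom_map, reassoc_of% h, assoc, assoc,
    reassoc_of% e₂, reassoc_of% e₁, ← MonoidalClosed.pre_comm_ihom_map, ← reassoc_of% pre_app_comp,
    ← reassoc_of% pre_app_comp, hg]

end Restrict

/-! ### Compatibility of `⋊` with the operad structures -/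

section RtimesComp

open MonoidalClosed (pre)
open scoped MonoidalClosed

variable (V : ChainComplex A ℤ)

/-- The product of the components of `⋊`, followed by the tensor product of operations. -/
def rtimesOperationsTensor (ns : List ℕ) :
    opsTensor (chainEndOperad V).obj ns ⟶
      (ihom (tensorPow (V.X 1 ⊞ V.X 0) ns.sum)).obj (tensorPow (V.X 1 ⊞ V.X 0) ns.length) :=
  opsTensorMap (rtimes V) ns ≫ operationsTensor A ihomTensor (V.X 1 ⊞ V.X 0) ns

/-- The tensor product of operations, with values in the object of chain maps. -/
def chainOperationsTensor (ns : List ℕ) :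
    opsTensor (chainEndOperad V).obj ns ⟶
      chainHom (tensorPow V ns.sum) (tensorPow V ns.length) :=
  operationsTensor A chainHomTensor V ns

lemma rtimesOperationsTensor_cons (n : ℕ) (ns : List ℕ) :
    rtimesOperationsTensor V (n :: ns) =
      (chainHomRestrict V (partialOne V n) (partialZero V n) ⊗ₘ rtimesOperationsTensor V ns) ≫
        ihomTensor _ _ _ _ ≫
          eHomWhiskerRight A (tensorPowAdd (V.X 1 ⊞ V.X 0) n ns.sum).hom _ ≫
            eHomWhiskerLeft A (tensorPow (V.X 1 ⊞ V.X 0) (n + ns.sum))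
              (tensorPowCons (V.X 1 ⊞ V.X 0) ns.length).hom := by
  rw [← rtimesMap_eq]
  exact tensorHom_comp_whiskerLeft_assoc (rtimesMap V n) (opsTensorMap (rtimes V) ns)
    (operationsTensor A ihomTensor (V.X 1 ⊞ V.X 0) ns) _

lemma chainOperationsTensor_cons (n : ℕ) (ns : List ℕ) :
    chainOperationsTensor V (n :: ns) =
      (𝟙 (chainHom (tensorPow V n) V) ⊗ₘ chainOperationsTensor V ns) ≫
        chainHomTensor _ _ _ _ ≫ eHomWhiskerRight A (tensorPowAdd V n ns.sum).hom _ ≫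
            eHomWhiskerLeft A (tensorPow V (n + ns.sum)) (tensorPowCons V ns.length).hom := by
  rw [id_tensorHom]
  rfl

lemma ihomId_map_eq_chainHomId_pre {S : A} {X : ChainComplex A ℤ} {n : ℤ} (f : S ⟶ X.X n) :
    MonoidalClosed.id S ≫ (ihom S).map f =
      chainHomId X ≫ chainHomEv X X n ≫ (pre f).app (X.X n) := by
  rw [reassoc_of% chainHomId_ev, ← MonoidalClosed.curry'_id, ← MonoidalClosed.curry'_id,
    MonoidalClosed.curry'_ihom_map, curry'_pre_app, id_comp, comp_id]

/-- This is `∂ F' = (F₁ ⊕ F₀) ∂`, one component at a time. The degrees must be treated together,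
since the total needed in degree `1` involves both. -/
lemma rtimesOperationsTensor_map (hV : IsZero (V.X (-1))) (ns : List ℕ) :
    rtimesOperationsTensor V ns ≫ (ihom _).map (partialZero V ns.length) =
      chainOperationsTensor V ns ≫ chainHomEv _ _ 0 ≫ (pre (partialZero V ns.sum)).app _ ∧
    rtimesOperationsTensor V ns ≫ (ihom _).map (partialOne V ns.length) =
      chainOperationsTensor V ns ≫ chainHomEv _ _ 1 ≫ (pre (partialOne V ns.sum)).app _ := by
  induction ns with
  | nil =>
    -- For the empty list both tensor products of operations are identities of unit objects.
    have key (n : ℤ) (f : 𝟙_ A ⟶ (𝟙_ (ChainComplex A ℤ)).X n) :=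
      (assoc (𝟙 (𝟙_ A)) _ _).trans ((id_comp _).trans (ihomId_map_eq_chainHomId_pre f))
    exact ⟨key 0 (partialZero V 0), key 1 (partialOne V 0)⟩
  | cons n ns ih =>
    have ht := ihom_map_total_of_ev_eq ih.2 ih.1
    -- For a single operation `f`, the projections of `⋊ f` to `V₁` and `V₀` are `f₁ a₁` and `f₀
    -- a₀`; the added identity presents `f` as the universal chain map.
    have h₁ := (chainHomRestrict_fst (V := V) (partialOne V n) (partialZero V n)).trans
      (id_comp _).symm
    have h₀ := (chainHomRestrict_snd (V := V) (partialOne V n) (partialZero V n)).trans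
      (id_comp _).symm
    rw [rtimesOperationsTensor_cons, chainOperationsTensor_cons]
    refine ⟨(assoc _ _ _).trans ((ihomTensor_whisker (partialZero_tensorPowAdd V n ns.sum)
      (tensorPowCons_partialZero V ns.length) (ihomTensor_tensorPair h₀ ih.1 0 (add_zero 0))).trans
        (assoc _ _ _).symm), (assoc _ _ _).trans
          ((ihomTensor_whisker (partialOne_tensorPowAdd V n ns.sum hV)
            (tensorPowCons_partialOne V ns.length hV) ?_).trans (assoc _ _ _).symm)⟩
    -- The two summands of `a₁` on a concatenation: the leftmost `V₁` lies in the first block, with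
    -- the total on the others, or it lies in a later block.
    have k₁ := ihomTensor_tensorPair h₁ ht 1 (add_zero 1)
    have k₂ := ihomTensor_tensorPair h₀ ih.2 1 (zero_add 1)
    rw [ihom_map_add, pre_app_add]
    simp only [Preadditive.comp_add]
    exact congrArg₂ (· + ·) k₁ k₂

lemma rtimes_comp (hV : IsZero (V.X (-1))) (ns : List ℕ) :
    (chainEndOperad V).comp ns ≫ rtimes V ns.sum =
      (rtimes V ns.length ⊗ₘ opsTensorMap (rtimes V) ns) ≫
        (endOperad (V.X 1 ⊞ V.X 0)).comp ns := by
  obtain ⟨h₀, h₁⟩ := rtimesOperationsTensor_map V hV ns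
  have h := chainHomComp_restrict (V := V) h₁ h₀
  rw [← rtimesMap_eq, ← rtimesMap_eq] at h
  exact h.trans (tensorHom_comp_whiskerLeft_assoc (rtimesMap V ns.length)
    (opsTensorMap (rtimes V) ns) (operationsTensor A ihomTensor (V.X 1 ⊞ V.X 0) ns) _).symm

lemma rtimes_act (hV : IsZero (V.X (-1))) (hV' : IsZero (V.X 2)) {n : ℕ}
    (σ : Equiv.Perm (Fin n)) :
    (chainEndOperad V).act σ ≫ rtimes V n = rtimes V n ≫ (endOperad (V.X 1 ⊞ V.X 0)).act σ := by
  have h := (tensorPowPerm_restrictsModBoundaries V hV σ).whiskerRight_chainHomRestrict hV'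
  rw [← rtimesMap_eq, ← MonoidalClosed.enrichedOrdinaryCategorySelf_eHomWhiskerRight] at h
  exact h

/-- As `X^{⊗ 1}` is `𝟙 ⊗ X`, the operadic unit is the left unitor; on one letter `∂` is the pair of
projections, which add up to the identity of `V₁ ⊕ V₀`. -/
lemma leftUnitor_restrict :
    chainHomOfHom (λ_ V).hom ≫ chainHomRestrict V
        (tensorPair unitZero biprod.fst 1 (zero_add 1)) (tensorPair unitZero biprod.snd 0
          (zero_add 0)) = MonoidalClosed.curry' (λ_ (V.X 1 ⊞ V.X 0)).hom := by
  rw [chainHomOfHom_restrict, reassoc_of% tensorPair_leftUnitor, reassoc_of% tensorPair_leftUnitor,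
    ← Preadditive.comp_add, biprod.total]
  exact congrArg _ (comp_id _)

lemma rtimes_one : (chainEndOperad V).one ≫ rtimes V 1 = (endOperad (V.X 1 ⊞ V.X 0)).one := by
  have h := rtimesMap_eq V 1
  rw [partialOne_one] at h
  exact (congrArg (chainHomOfHom (λ_ V).hom ≫ ·) h).trans (leftUnitor_restrict V)

end RtimesComp

end

theorem mainTheorem5 {A : Type u} [Category.{v} A] [Abelian A] [MonoidalCategory A]
    [SymmetricCategory A] [MonoidalClosed A] [HasLimits A] [HasColimits A]
    (V : ChainComplex A ℤ) (hV : ∀ i : ℤ, i ≠ 0 → i ≠ 1 → IsZero (V.X i)) :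
    IsOperadMorphism (chainEndOperad V) (endOperad (V.X 1 ⊞ V.X 0)) (rtimes V) where
  act σ := rtimes_act V (hV (-1) (by decide) (by decide)) (hV 2 (by decide) (by decide)) σ
  one := rtimes_one V
  comp ns := rtimes_comp V (hV (-1) (by decide) (by decide)) ns
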